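/- **Theorem.** Setting. Let $G$ be a finite graph (multiple edges allowed) drawn without crossings in a closed disk, with at least one *boundary leg*, i.e. an edge that ends on the boundary circle; every edge either joins vertices of $G$ or is a boundary leg attached to exactly one vertex, every vertex has at least one leg, and every connected component of $G$ has a boundary leg. The points of the dual graph are the regions into which $G$ divides the disk, two different regions being adjacent if they are separated by a leg; a *boundary region* is one that touches the boundary circle at an arc between consecutive boundary legs. Assume that $G$ is *non-positively curved*: for every point $x$ of the dual graph, the distance $d(x,\cdot)$ (the least number of legs that have to be cut) has no local maximum away from the boundary, i.e. each non-boundary region $u$ is adjacent to a region $v$ with $d(x,v)>d(x,u)$. A *HaPPY network* on $G$ with legs of dimension $D\ge 1$ places on each vertex a *perfect tensor*: a tensor with an even number $2n$ of legs, each of dimension $D$, such that for every choice of $n$ of its legs, contracting it with its complex conjugate along these $n$ legs gives the identity on the other $n$ legs. Tensors are contracted by placing the (unnormalized) maximally entangled pair $\sum_{m}|m\rangle|m\rangle$ on every edge. Let $A$ be a single boundary interval, i.e. a set of consecutive boundary legs. A *cut enclosing $A$* is a path $\gamma$ in the dual graph from the boundary region at one end of $A$ to the boundary region at the other end, crossing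 no leg twice (boundary legs may be crossed), which separates $A$ together with a set of vertices from the remaining boundary legs $\bar A$ and the remaining vertices; the legs crossed are exactly those with one end on each side. Put $\dim\gamma=D^{|\gamma|}$, where $|\gamma|$ is the number of legs crossed. Contracting the tensors on the two sides of $\gamma$ separately gives two linear maps from the Hilbert space of the cut legs, namely $C$ to that of the legs in $A$ and $\bar C$ to that of the legs in $\bar A$ (a cut boundary leg contributes the identity to the map on its outer side). Claim. For every cut $\gamma$ enclosing $A$, the following are equivalent: 1. $\gamma$ defines an isometry on both sides, up to normalization: there are $c,\bar c>0$ such that $cC$ and $\bar c\,\bar C$ are isometries, $(cC)^\dagger (cC)=\mathbb I$ and $(\bar c\,\bar C)^\dagger(\bar c\,\bar C)=\mathbb I$; 2. $\log\dim\gamma$ is minimal: $\log\dim\gamma\le\log\dim\gamma'$ for every cut $\gamma'$ enclosing $A$. -/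

import Mathlib

noncomputable section

open scoped Matrix

/-- A finite planar graph drawn in a disk, with vertices `V` (the places where tensors sit) and
some edges ending on the boundary circle of the disk (the boundary legs), presented as a
combinatorial map: every edge (leg) consists of two oppositely oriented half-edges, the *darts*.
The boundary circle is collapsed to one extra point of the sphere, written `none : Option V`;
a dart based at `none` is the outer end of a boundary leg, and these darts inherit the cyclic
order of the boundary legs along the circle. Multiple edges are allowed. -/
structure DiskGraph (V Dart : Type*) [Fintype V] [Fintype Dart] where
  /-- The point at which a dart is based: a vertex, or the (collapsed) boundary circle. -/
  site : Dart → Option V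
  /-- The other end of the same leg. -/
  flip : Equiv.Perm Dart
  /-- The counterclockwise successor among the darts based at the same point. -/
  rot : Equiv.Perm Dart
  flip_flip : ∀ d, flip (flip d) = d
  flip_ne : ∀ d, flip d ≠ d
  /-- There are boundary legs, and no vertex is without legs. -/
  site_surjective : Function.Surjective site
  site_eq_iff : ∀ d e, site d = site e ↔ rot.SameCycle d e
  /-- A boundary leg is attached to a vertex of the graph. -/
  boundary_attached : ∀ d, site d = none → site (flip d) ≠ none
  /-- Every part of the graph is attached to the boundary circle. -/
  connected : MulAction.IsPretransitive (Subgroup.closure {rot, flip}) Dart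
  /-- Genus zero: points + faces = edges + 2, where the faces are the cycles of
  `rot⁻¹ * flip`. -/
  euler : Fintype.card (Option V) + Nat.card (Quotient (Equiv.Perm.SameCycle.setoid (rot⁻¹ * flip)))
    = Nat.card (Quotient (Equiv.Perm.SameCycle.setoid flip)) + 2

namespace DiskGraph

variable {V Dart : Type*} [Fintype V] [Fintype Dart] (G : DiskGraph V Dart)

/-- The faces, that is, the points of the dual graph. -/
abbrev Face : Type _ := Quotient (Equiv.Perm.SameCycle.setoid (G.rot⁻¹ * G.flip))

/-- The face to the left of a dart. (The face to its right is `G.face (G.flip d)`.) -/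
def face (d : Dart) : G.Face := Quotient.mk _ d

/-- A face is a boundary face if it touches the boundary circle. -/
def IsBoundaryFace (u : G.Face) : Prop := ∃ d, G.site d = none ∧ G.face d = u

/-- The dual graph: two faces are adjacent when some leg separates them. Distances in it count
the legs cut. -/
def dual : SimpleGraph G.Face where
  Adj u v := u ≠ v ∧ ∃ d, G.face d = u ∧ G.face (G.flip d) = v
  symm := ⟨fun u v h => by
    obtain ⟨hne, d, hu, hv⟩ := h
    exact ⟨hne.symm, G.flip d, hv, by rw [G.flip_flip]; exact hu⟩⟩
  loopless := ⟨fun _ h => h.1 rfl⟩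

/-- Non-positive curvature: the distance from any point of the dual graph has no local maximum
away from the boundary. -/
def NonpositivelyCurved : Prop :=
  ∀ x u : G.Face, ¬ G.IsBoundaryFace u → ∃ v, G.dual.Adj u v ∧ G.dual.dist x u < G.dual.dist x v

/-- `G.IsDualPath x γ y`: the list `γ` of darts describes a path in the dual graph from the face
`x` to the face `y`; the step given by a dart `d` crosses the leg of `d` from the right of `d` to
the left of `d`. -/
def IsDualPath : G.Face → List Dart → G.Face → Prop
  | x, [], y => x = y
  | x, d :: γ, y => G.face (G.flip d) = x ∧ IsDualPath (G.face d) γ y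

/-- A boundary interval: `length` consecutive boundary legs, beginning with `start`. -/
structure Interval where
  start : Dart
  start_boundary : G.site start = none
  length : ℕ
  length_le : length ≤ Nat.card {d // G.site d = none}

namespace Interval

variable {G} (A : G.Interval)

/-- The boundary legs in the interval, represented by their outer darts. -/
def legs : Set Dart := {d | ∃ i < A.length, d = (G.rot ^ i) A.start}

/-- The boundary face just before the first leg of the interval. -/
def first : G.Face := G.face (G.rot⁻¹ A.start)

/-- The boundary face just after the last leg of the interval. -/
def last : G.Face := G.face ((G.rot ^ A.length) (G.rot⁻¹ A.start))

end Interval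

/-- The leg ends on one side of a partition: those at the vertices in `S`, and the outer ends of
the boundary legs in `A`. -/
def side (S : Set V) (A : Set Dart) : Set Dart :=
  {d | (G.site d = none ∧ d ∈ A) ∨ ∃ v ∈ S, G.site d = some v}

/-- The cut legs, each represented by its end on the side of `S` and `A`. -/
abbrev CutLeg (S : Set V) (A : Set Dart) : Type _ :=
  {d : Dart // d ∈ G.side S A ∧ G.flip d ∉ G.side S A}

/-- The boundary legs in `A`. -/
abbrev BoundaryLeg (A : Set Dart) : Type _ := {d : Dart // G.site d = none ∧ d ∈ A}

/-- A cut enclosing the boundary interval `A`: a path in the dual graph between the two ends of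
`A`, crossing no leg twice, together with the set `region` of vertices it separates off with `A`;
the legs crossed are exactly those with one end on the side of `A` and one end on the other side.
(A boundary leg may be crossed as well.) -/
structure Cut (A : G.Interval) where
  region : Set V
  path : List Dart
  isDualPath : G.IsDualPath A.first path A.last
  nodup : path.Nodup
  mem_path : ∀ d, d ∈ path ↔ d ∈ G.side region A.legs ∧ G.flip d ∉ G.side region A.legs

end DiskGraph

open Classical in
/-- The matrix of a tensor with legs `L` of dimension `D`, from the legs outside `K` to the legs
in `K`. -/
def tensorMatrix {L : Type*} {D : ℕ} (T : (L → Fin D) → ℂ) (K : Finset L) :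
    Matrix ({l // l ∈ K} → Fin D) ({l // l ∉ K} → Fin D) ℂ :=
  fun p r => T fun l => if h : l ∈ K then p ⟨l, h⟩ else r ⟨l, h⟩

open Classical in
/-- A perfect tensor: it has an even number of legs, and contracting it with its complex conjugate
along any half of the legs gives the identity on the other half. -/
def IsPerfectTensor {L : Type*} [Fintype L] {D : ℕ} (T : (L → Fin D) → ℂ) : Prop :=
  Even (Fintype.card L) ∧
    ∀ K : Finset L, 2 * K.card = Fintype.card L → tensorMatrix T K * (tensorMatrix T K)ᴴ = 1

open Classical in
/-- A HaPPY network with legs of dimension `D`: perfect tensors on the vertices of a non-positively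
curved graph in the disk. -/
structure HaPPYNetwork (V Dart : Type*) [Fintype V] [Fintype Dart] (D : ℕ) extends
    DiskGraph V Dart where
  dim_pos : 0 < D
  curved : toDiskGraph.NonpositivelyCurved
  tensor : (v : V) → ({d : Dart // site d = some v} → Fin D) → ℂ
  perfect : ∀ v, IsPerfectTensor (tensor v)

namespace HaPPYNetwork

variable {V Dart : Type*} [Fintype V] [Fintype Dart] {D : ℕ} (N : HaPPYNetwork V Dart D)

open Classical in
/-- The map from the cut legs to the boundary legs in `A`, given by the part of the network on the
side of `S` and `A`: the tensors in `S` are contracted with the (unnormalized) maximally entangled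
pair `∑ m, |m⟩|m⟩` on every uncut leg. A boundary leg in `A` that is itself cut contributes the
identity. -/
def blockMap (S : Set V) (A : Set Dart) :
    Matrix (N.BoundaryLeg A → Fin D) (N.CutLeg S A → Fin D) ℂ :=
  fun a k => ∑ h : (N.side S A → Fin D),
    if (∀ d : N.BoundaryLeg A, h ⟨d.1, Or.inl d.2⟩ = a d) ∧
       (∀ d : N.CutLeg S A, h ⟨d.1, d.2.1⟩ = k d) ∧
       (∀ d e : N.side S A, N.flip d.1 = e.1 → h d = h e)
    then ∏ v : S, N.tensor v fun d => h ⟨d.1, Or.inr ⟨v, v.2, d.2⟩⟩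
    else 0

variable {N} {A : N.Interval} (γ : N.Cut A)

/-- The tensor `C`, from the cut legs to the interval `A`. -/
def inner := N.blockMap γ.region A.legs

/-- The tensor `C̄`, from the cut legs to the complementary boundary legs. -/
def outer := N.blockMap γ.regionᶜ A.legsᶜ

/-- The dimension of the Hilbert space of the cut legs. -/
def cutDim : ℕ := D ^ Nat.card (N.CutLeg γ.region A.legs)

end HaPPYNetwork

open Classical in
/-- A matrix defines an isometry up to normalization: a positive multiple of it is an isometry. -/
def IsIsometryUpToScale {m n : Type*} [Fintype m] [Fintype n] (M : Matrix m n ℂ) : Prop :=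
  ∃ c : ℝ, 0 < c ∧ ((c : ℂ) • M)ᴴ * ((c : ℂ) • M) = 1

open Classical in
/-- An isometric cut: both tensors into which it divides the network are isometries from the cut
legs to the boundary (up to normalization). -/
def HaPPYNetwork.IsIsometricCut {V Dart : Type*} [Fintype V] [Fintype Dart] {D : ℕ}
    {N : HaPPYNetwork V Dart D} {A : N.Interval} (γ : N.Cut A) : Prop :=
  IsIsometryUpToScale (HaPPYNetwork.inner γ) ∧ IsIsometryUpToScale (HaPPYNetwork.outer γ)

end

/-! Isometric implies minimal: for every cut the state of the network, as a matrix between $A$ and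
$\bar A$, factors as $C\bar C^T$ through the cut space, so its rank is at most $\dim\gamma'$ for
every cut $\gamma'$ (`stateMatrix_eq`). If both factors at $\gamma$ have left inverses, the rank is
at least $\dim\gamma$.

Minimal implies isometric: let $x$ be the boundary face at the first end of $A$, and orient each leg
by the sign of the increment of $d(x,\cdot)$ across it. Perfect tensors have even degree, so the
dual graph is bipartite and every increment is $\pm1$; the increments around a vertex sum to zero,
so half of its legs go in and half go out, and its tensor is an isometric gate
(`EvenDegrees.grad_eq`, `EvenDegrees.two_mul_card`). Non-positive curvature excludes directed cycles
(`NonpositivelyCurved.exists_last`), so the gates form a circuit. The increments along a cut path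
sum to the distance between the ends of $A$. A shortest path is itself a cut
(`EvenDegrees.exists_geodesic_cut`), hence a minimal cut has this length and every increment along
it is $+1$: all cut legs enter the circuit on the side of $A$, and for the reversed orientation on
the other side. Removing gates one by one from the last (`circuit_sum`) gives the isometry. A
boundary leg on which the circuit enters does no harm: it is half of a maximally entangled pair, and
changes only the normalization.

The topology of the disk enters only through Euler's formula, as the vanishing of first homology
(`exists_face_potential`, `exists_site_potential`). -/

open scoped Matrix
open ComplexConjugate

/-! ### Vanishing homology from Euler's formula. -/

namespace DiskGraph

/-- Exactness of a pair of matrices from orthogonality and a rank count. -/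
theorem exists_mulVec_eq_of_rank {K L P Q : Type*} [Field K] [Fintype L] [Fintype P] [Fintype Q]
    (M : Matrix L P K) (N : Matrix L Q K) (hMN : Nᵀ * M = 0)
    (hrank : M.rank + N.rank = Fintype.card L) (c : L → K) (hc : Nᵀ *ᵥ c = 0) :
    ∃ p, M *ᵥ p = c := by
  classical
  have hle : LinearMap.range M.mulVecLin ≤ LinearMap.ker Nᵀ.mulVecLin := by
    rintro _ ⟨p, rfl⟩
    rw [LinearMap.mem_ker, Matrix.mulVecLin_apply, Matrix.mulVecLin_apply, Matrix.mulVec_mulVec, hMN,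
      Matrix.zero_mulVec]
  have h1 : Module.finrank K (LinearMap.range M.mulVecLin) = M.rank := rfl
  have h2 := LinearMap.finrank_range_add_finrank_ker Nᵀ.mulVecLin
  have h3 : Module.finrank K (LinearMap.range Nᵀ.mulVecLin) = N.rank := N.rank_transpose
  rw [h3, Module.finrank_fintype_fun_eq_card] at h2
  have heq := Submodule.eq_of_le_of_finrank_eq hle (by omega)
  have : c ∈ LinearMap.range M.mulVecLin := by
    rw [heq, LinearMap.mem_ker, Matrix.mulVecLin_apply, hc]
  simpa using this

variable {V Dart : Type*} [Fintype V] [Fintype Dart] (G : DiskGraph V Dart)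

/-- The legs of the graph, as unoriented edges. -/
abbrev Leg : Type _ := Quotient (Equiv.Perm.SameCycle.setoid G.flip)

open Classical in
noncomputable instance : Fintype G.Leg := Fintype.ofFinite _

open Classical in
noncomputable instance : Fintype G.Face := Fintype.ofFinite _

/-- `rot⁻¹ * flip` carries `flip d` to `rot⁻¹ d`. This identity makes sums of face differences
around a site telescope. -/
theorem face_flip (d : Dart) : G.face (G.flip d) = G.face (G.rot⁻¹ d) := by
  refine Quotient.sound ⟨1, ?_⟩
  simp [G.flip_flip]

theorem site_rot (d : Dart) : G.site (G.rot d) = G.site d :=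
  (G.site_eq_iff _ _).2 ⟨-1, by simp⟩

theorem site_rot_inv (d : Dart) : G.site (G.rot⁻¹ d) = G.site d :=
  (G.site_eq_iff _ _).2 ⟨1, by simp⟩

/-- The chosen orientation of a leg. -/
noncomputable def legDart (l : G.Leg) : Dart := Quotient.out l

theorem sameCycle_flip {d e : Dart} (h : G.flip.SameCycle d e) : e = d ∨ e = G.flip d := by
  obtain ⟨k, rfl⟩ := h
  have h2 : G.flip * G.flip = 1 := Equiv.ext G.flip_flip
  rcases Int.even_or_odd' k with ⟨m, rfl | rfl⟩
  · left; rw [zpow_mul, zpow_two, h2]; simp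
  · right; rw [zpow_add, zpow_mul, zpow_two, h2]; simp

theorem legDart_mk (d : Dart) : G.legDart (Quotient.mk _ d) = d ∨
    G.legDart (Quotient.mk _ d) = G.flip d := by
  apply G.sameCycle_flip
  exact (Quotient.exact (Quotient.out_eq (Quotient.mk (Equiv.Perm.SameCycle.setoid G.flip) d))).symm

theorem mk_legDart (l : G.Leg) : (Quotient.mk _ (G.legDart l) : G.Leg) = l := Quotient.out_eq l

theorem mk_flip (d : Dart) : (Quotient.mk _ (G.flip d) : G.Leg) = Quotient.mk _ d :=
  Quotient.sound (⟨1, by simp [G.flip_flip]⟩ : G.flip.SameCycle _ _)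

/-- A sum over darts is a sum over legs of the two orientations. -/
theorem sum_legDart {K : Type*} [AddCommMonoid K] (h : Dart → K) :
    ∑ l : G.Leg, (h (G.legDart l) + h (G.flip (G.legDart l))) = ∑ d, h d := by
  classical
  rw [← Finset.sum_fiberwise (s := Finset.univ) (g := fun d : Dart => (Quotient.mk _ d : G.Leg))]
  refine Finset.sum_congr rfl fun l _ => ?_
  have : (Finset.univ.filter fun d : Dart => (Quotient.mk _ d : G.Leg) = l)
      = {G.legDart l, G.flip (G.legDart l)} := by
    ext d
    simp only [Finset.mem_filter, Finset.mem_univ, true_and, Finset.mem_insert,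
      Finset.mem_singleton]
    constructor
    · rintro rfl
      rcases G.legDart_mk d with h | h
      · exact Or.inl h.symm
      · right; rw [h, G.flip_flip]
    · rintro (h | h)
      · rw [h, G.mk_legDart]
      · rw [h, G.mk_flip, G.mk_legDart]
  rw [this, Finset.sum_pair (G.flip_ne _).symm]

open Classical in
/-- The coboundary matrix of a partition of the darts into the fibres of `π`. -/
noncomputable def coboundary (K : Type*) [Field K] {P : Type*} (π : Dart → P) : Matrix G.Leg P K :=
  fun l u => (if π (G.legDart l) = u then 1 else 0) - if π (G.flip (G.legDart l)) = u then 1 else 0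

section

variable {K : Type*} [Field K] {P : Type*} (π : Dart → P)

theorem coboundary_mulVec [Fintype P] (p : P → K) (l : G.Leg) :
    (G.coboundary K π *ᵥ p) l = p (π (G.legDart l)) - p (π (G.flip (G.legDart l))) := by
  classical
  simp [coboundary, Matrix.mulVec, dotProduct, sub_mul, Finset.sum_sub_distrib]

/-- The hypothesis says that the classes are connected through legs, so the kernel consists of the
constants and rank-nullity applies. -/
theorem coboundary_rank [Fintype P] [Nonempty P]
    (hπ : ∀ p : P → K, (∀ d, p (π d) = p (π (G.flip d))) → ∃ a, ∀ u, p u = a) :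
    (G.coboundary K π).rank + 1 = Fintype.card P := by
  have h2 := LinearMap.finrank_range_add_finrank_ker (G.coboundary K π).mulVecLin
  rw [Module.finrank_fintype_fun_eq_card] at h2
  have hker : LinearMap.ker (G.coboundary K π).mulVecLin = Submodule.span K {fun _ => 1} := by
    ext p
    rw [LinearMap.mem_ker, Submodule.mem_span_singleton, Matrix.mulVecLin_apply]
    constructor
    · intro h
      obtain ⟨a, ha⟩ := hπ p fun d => by
        have := congrFun h (Quotient.mk _ d)
        rw [coboundary_mulVec] at this
        have := sub_eq_zero.1 this
        rcases G.legDart_mk d with h | h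
        · rw [h] at this; exact this
        · rw [h, G.flip_flip] at this; exact this.symm
      exact ⟨a, by ext u; simp [ha]⟩
    · rintro ⟨a, rfl⟩
      ext l
      rw [coboundary_mulVec]; simp
  have h1 : Module.finrank K (LinearMap.ker (G.coboundary K π).mulVecLin) = 1 := by
    rw [hker]
    obtain ⟨u⟩ := ‹Nonempty P›
    exact finrank_span_singleton fun h => one_ne_zero (congrFun h u)
  rw [h1] at h2
  exact h2

/-- The transpose is the divergence: by antisymmetry the two orientations of a leg contribute with
the signs found in the coboundary. -/
theorem coboundary_transpose_mulVec [DecidableEq P] (c : Dart → K)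
    (hc : ∀ d, c (G.flip d) = - c d) (u : P) :
    ((G.coboundary K π)ᵀ *ᵥ fun l => c (G.legDart l)) u = ∑ d with π d = u, c d := by
  rw [Finset.sum_filter, ← G.sum_legDart]
  refine Finset.sum_congr rfl fun l _ => ?_
  simp only [Matrix.transpose_apply, coboundary, hc]
  split_ifs <;> simp

end

theorem eq_of_legDart {K : Type*} [Field K] (c e : Dart → K) (hc : ∀ d, c (G.flip d) = - c d)
    (he : ∀ d, e (G.flip d) = - e d) (h : ∀ l, c (G.legDart l) = e (G.legDart l)) (d : Dart) :
    c d = e d := by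
  have := h (Quotient.mk _ d)
  rcases G.legDart_mk d with h | h
  · rwa [h] at this
  · rw [h, hc, he] at this; exact neg_injective this

/-- A function on the darts that is invariant under both permutations is constant. -/
theorem eq_of_invariant {K : Type*} (q : Dart → K) (hf : ∀ d, q (G.flip d) = q d)
    (hr : ∀ d, q (G.rot d) = q d) (d e : Dart) : q d = q e := by
  have := G.connected
  obtain ⟨⟨σ, hσ⟩, rfl⟩ := MulAction.exists_smul_eq (Subgroup.closure {G.rot, G.flip}) d e
  change q d = q (σ d)
  induction hσ using Subgroup.closure_induction generalizing d with
  | mem x hx =>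
    rcases hx with rfl | hx
    · exact (hr d).symm
    · rw [Set.mem_singleton_iff] at hx; subst hx; exact (hf d).symm
  | one => rfl
  | mul x y _ _ hx hy => exact (hy d).trans (hx (y d))
  | inv x _ hx => simpa using (hx (x⁻¹ d)).symm

theorem site_invariant_const {K : Type*} (p : Option V → K)
    (h : ∀ d, p (G.site d) = p (G.site (G.flip d))) : ∃ a, ∀ u, p u = a := by
  refine ⟨p none, fun u => ?_⟩
  obtain ⟨d, rfl⟩ := G.site_surjective u
  obtain ⟨e, he⟩ := G.site_surjective none
  rw [← he]
  exact G.eq_of_invariant (fun d => p (G.site d)) (fun d => (h d).symm)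
    (fun d => by simp only [G.site_rot]) d e

theorem face_invariant_const {K : Type*} (p : G.Face → K)
    (h : ∀ d, p (G.face d) = p (G.face (G.flip d))) : ∃ a, ∀ u, p u = a := by
  obtain ⟨e, he⟩ := G.site_surjective none
  refine ⟨p (G.face e), fun u => ?_⟩
  induction u using Quotient.inductionOn with
  | h d =>
    refine G.eq_of_invariant (fun d => p (G.face d)) (fun d => (h d).symm) (fun d => ?_) d e
    -- The right face of `rot d` is the left face of `d`, so invariance across legs becomes
    -- invariance under `rot`.
    have := h (G.rot d)
    rw [face_flip] at this
    simpa using this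

instance : Nonempty G.Face := ⟨G.face (G.site_surjective none).choose⟩

/-- Around a site, the two sides of the darts agree up to a permutation. -/
theorem sum_site_face {K : Type*} [AddCommGroup K] [DecidableEq V] (p : G.Face → K)
    (s : Option V) : ∑ d with G.site d = s, (p (G.face d) - p (G.face (G.flip d))) = 0 := by
  rw [Finset.sum_sub_distrib, sub_eq_zero]
  simp only [face_flip]
  exact Finset.sum_equiv G.rot (by simp [site_rot]) (by simp)

/-- The boundary of a boundary is zero, tested on indicators of faces. -/
theorem coboundary_site_face (K : Type*) [Field K] :
    (G.coboundary K G.site)ᵀ * G.coboundary K G.face = 0 := by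
  classical
  refine Matrix.ext_of_mulVec_single fun u => ?_
  rw [← Matrix.mulVec_mulVec]
  ext s
  have := G.coboundary_transpose_mulVec (K := K) G.site
    (fun d => (Pi.single u 1 : G.Face → K) (G.face d)
      - (Pi.single u 1 : G.Face → K) (G.face (G.flip d)))
    (fun d => by simp [G.flip_flip]) s
  rw [G.sum_site_face] at this
  rw [Matrix.zero_mulVec, Pi.zero_apply, ← this]
  congr 1
  ext l
  rw [coboundary_mulVec]

/-- Both ranks are one less than the number of classes; Euler's formula absorbs the two missing
units. This is the dimension count for exactness at the legs. -/
theorem coboundary_rank_add (K : Type*) [Field K] :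
    (G.coboundary K G.face).rank + (G.coboundary K G.site).rank = Fintype.card G.Leg := by
  have h1 := G.coboundary_rank (K := K) G.site (G.site_invariant_const)
  have h2 := G.coboundary_rank (K := K) G.face (G.face_invariant_const)
  have h3 := G.euler
  rw [Nat.card_eq_fintype_card, Nat.card_eq_fintype_card] at h3
  change _ + Fintype.card G.Face = Fintype.card G.Leg + 2 at h3
  omega

/-- The disk is simply connected: a flow that is conserved at every site is the difference of a
potential on the faces. -/
theorem exists_face_potential {K : Type*} [Field K] [DecidableEq V] (c : Dart → K)
    (hc : ∀ d, c (G.flip d) = - c d) (h : ∀ s, ∑ d with G.site d = s, c d = 0) :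
    ∃ p : G.Face → K, ∀ d, c d = p (G.face d) - p (G.face (G.flip d)) := by
  obtain ⟨p, hp⟩ := exists_mulVec_eq_of_rank (G.coboundary K G.face) (G.coboundary K G.site)
    (G.coboundary_site_face K) (G.coboundary_rank_add K) (fun l => c (G.legDart l))
    (by ext s; rw [coboundary_transpose_mulVec _ _ _ hc, h]; rfl)
  refine ⟨p, G.eq_of_legDart _ _ hc (fun d => by simp [G.flip_flip]) fun l => ?_⟩
  rw [← congrFun hp l, coboundary_mulVec]

/-- The dual statement: a closed chain of dual edges bounds a combination of sites. -/
theorem exists_site_potential {K : Type*} [Field K] [DecidableEq G.Face] (c : Dart → K)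
    (hc : ∀ d, c (G.flip d) = - c d) (h : ∀ u, ∑ d with G.face d = u, c d = 0) :
    ∃ s : Option V → K, ∀ d, c d = s (G.site d) - s (G.site (G.flip d)) := by
  obtain ⟨p, hp⟩ := exists_mulVec_eq_of_rank (G.coboundary K G.site) (G.coboundary K G.face)
    (by rw [← Matrix.transpose_transpose (G.coboundary K G.site), ← Matrix.transpose_mul,
      coboundary_site_face, Matrix.transpose_zero])
    ((add_comm _ _).trans (G.coboundary_rank_add K)) (fun l => c (G.legDart l))
    (by ext s; rw [coboundary_transpose_mulVec _ _ _ hc, h]; rfl)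
  refine ⟨p, G.eq_of_legDart _ _ hc (fun d => by simp [G.flip_flip]) fun l => ?_⟩
  rw [← congrFun hp l, coboundary_mulVec]

end DiskGraph

/-! ### The orientation of the legs by distance: balance and acyclicity. -/

namespace DiskGraph

variable {V Dart : Type*} [Fintype V] [Fintype Dart] (G : DiskGraph V Dart)

/-- Every vertex has even degree. -/
def EvenDegrees : Prop := ∀ v, Even (Nat.card {d // G.site d = some v})

variable {G}

/-- At the boundary point evenness follows by handshaking, as `flip` pairs off all darts. -/
theorem EvenDegrees.even_card [DecidableEq V] (hG : G.EvenDegrees) (s : Option V) :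
    Even (Finset.univ.filter fun d => G.site d = s).card := by
  have hv : ∀ v, Even (Finset.univ.filter fun d => G.site d = some v).card := fun v => by
    have := hG v
    rwa [Nat.card_eq_fintype_card, Fintype.card_subtype] at this
  have h1 : ∑ s : Option V, (Finset.univ.filter fun d => G.site d = s).card = Fintype.card Dart :=
    (Finset.card_eq_sum_card_fiberwise fun _ _ => Finset.mem_univ _).symm
  have h2 : Even (Fintype.card Dart) := by
    rw [Fintype.card_eq_sum_ones, ← G.sum_legDart]
    exact Finset.even_sum _ fun _ _ => ⟨1, rfl⟩
  cases s with
  | some v => exact hv v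
  | none =>
    rw [Fintype.sum_option] at h1
    rw [← h1, Nat.even_add] at h2
    exact h2.2 (Finset.even_sum _ fun v _ => hv v)

/-- The dual graph of a graph with even degrees is bipartite. -/
theorem EvenDegrees.exists_coloring (hG : G.EvenDegrees) :
    ∃ p : G.Face → ZMod 2, ∀ d, p (G.face d) - p (G.face (G.flip d)) = 1 := by
  classical
  -- Modulo 2 the constant flow 1 is antisymmetric, and conserved because degrees are even; its
  -- potential is a 2-colouring.
  obtain ⟨p, hp⟩ := G.exists_face_potential (K := ZMod 2) (fun _ => 1) (fun _ => by decide)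
    (fun s => by
      rw [Finset.sum_const, nsmul_one]
      exact (ZMod.natCast_eq_zero_iff_even).2 (hG.even_card s))
  exact ⟨p, fun d => (hp d).symm⟩

theorem EvenDegrees.adj (hG : G.EvenDegrees) (d : Dart) :
    G.dual.Adj (G.face d) (G.face (G.flip d)) := by
  obtain ⟨p, hp⟩ := hG.exists_coloring
  refine ⟨fun h => ?_, d, rfl, rfl⟩
  have := hp d
  rw [h, sub_self] at this
  exact zero_ne_one this

theorem dual_connected : G.dual.Connected := by
  have hpre : G.dual.Preconnected := fun x u => by
    obtain ⟨a, ha⟩ := G.face_invariant_const (fun u => G.dual.Reachable x u) fun d => by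
      by_cases h : G.face d = G.face (G.flip d)
      · rw [h]
      · have hadj : G.dual.Adj (G.face d) (G.face (G.flip d)) := ⟨h, d, rfl, rfl⟩
        exact propext ⟨fun h => h.trans hadj.reachable, fun h => h.trans hadj.symm.reachable⟩
    exact (ha u).trans (ha x).symm ▸ SimpleGraph.Reachable.refl x
  exact ⟨hpre⟩

variable (G) in
/-- The increment of the distance from `x` across the leg of a dart, from the right to the left. -/
noncomputable def grad (x : G.Face) (d : Dart) : ℤ :=
  (G.dual.dist x (G.face d) : ℤ) - G.dual.dist x (G.face (G.flip d))

theorem grad_flip (x : G.Face) (d : Dart) : G.grad x (G.flip d) = - G.grad x d := by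
  simp [grad, G.flip_flip]

theorem sum_grad [DecidableEq V] (x : G.Face) (s : Option V) :
    ∑ d with G.site d = s, G.grad x d = 0 :=
  G.sum_site_face (fun u => (G.dual.dist x u : ℤ)) s

/-- The parity of the distance is given by the 2-colouring, so across a leg the distance must
change, and it changes by at most one. -/
theorem EvenDegrees.grad_eq (hG : G.EvenDegrees) (x : G.Face) (d : Dart) :
    G.grad x d = 1 ∨ G.grad x d = -1 := by
  obtain ⟨p, hp⟩ := hG.exists_coloring
  have hw : ∀ {u v : G.Face} (w : G.dual.Walk u v), p u - p v = (w.length : ZMod 2) := by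
    intro u v w
    induction w with
    | nil => simp
    | cons h w ih =>
      have h' := h
      obtain ⟨-, d, hu, hv⟩ := h'
      rw [SimpleGraph.Walk.length_cons, Nat.cast_add, ← ih, Nat.cast_one, ← hp d, hu, hv]; ring
  have hdist : ∀ u, p x - p u = (G.dual.dist x u : ZMod 2) := fun u => by
    obtain ⟨w, hw'⟩ := dual_connected.exists_walk_length_eq_dist x u
    rw [← hw', hw]
  have hne : G.dual.dist x (G.face d) ≠ G.dual.dist x (G.face (G.flip d)) := fun h => by
    have h1 := hdist (G.face d)
    rw [h, ← hdist] at h1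
    have h2 := hp d
    rw [sub_right_inj.1 h1, sub_self] at h2
    exact zero_ne_one h2
  have := (hG.adj d).diff_dist_adj (u := x)
  unfold grad
  omega

theorem EvenDegrees.two_mul_card [DecidableEq V] (hG : G.EvenDegrees) (x : G.Face) (s : Option V) :
    2 * (Finset.univ.filter fun d => G.site d = s ∧ G.grad x d = 1).card
      = (Finset.univ.filter fun d => G.site d = s).card := by
  have h := sum_grad x s
  have h1 : ∀ d, G.grad x d = 2 * (if G.grad x d = 1 then 1 else 0) - 1 := fun d => by
    rcases hG.grad_eq x d with h | h <;> simp [h]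
  rw [Finset.sum_congr rfl fun d _ => h1 d, Finset.sum_sub_distrib, ← Finset.mul_sum,
    Finset.sum_boole, Finset.filter_filter] at h
  simp only [Finset.sum_const, nsmul_one] at h
  omega

/-- In a non-positively curved graph there is no circulation among the vertices along which the
distance increases from the right to the left. -/
theorem NonpositivelyCurved.circulation_eq_zero [DecidableEq V] (hc : G.NonpositivelyCurved)
    {x : G.Face} (hx : G.IsBoundaryFace x) (w : Dart → ℚ) (hw0 : ∀ d, 0 ≤ w d)
    (hw : ∀ d, w d ≠ 0 → G.grad x d = 1) (hwn : ∀ d, G.site d = none → w d = 0 ∧ w (G.flip d) = 0)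
    (hcirc : ∀ s, ∑ d with G.site d = s, (w d - w (G.flip d)) = 0) (d : Dart) : w d = 0 := by
  -- Where `p` is larger on the left of a dart, `w` is positive there, so the distance from `x` is
  -- larger on the left too: a strict rise of `p` forces a rise of distance.
  obtain ⟨p, hp⟩ := G.exists_face_potential (fun d => w d - w (G.flip d))
    (fun d => by simp [G.flip_flip]) hcirc
  -- the potential is constant on the boundary faces
  have hb : ∀ u, G.IsBoundaryFace u → p u = p x := by
    obtain ⟨e, he, hex⟩ := hx
    rintro _ ⟨d, hd, rfl⟩
    rw [← hex]
    have hz : ∀ d, G.site d = none → p (G.face (G.rot⁻¹ d)) = p (G.face d) := fun d hd => by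
      have := hp d
      rw [(hwn d hd).1, (hwn d hd).2, face_flip] at this
      linarith
    obtain ⟨k, rfl⟩ := (G.site_eq_iff d e).1 (hd.trans he.symm)
    have hs : ∀ k : ℤ, G.site ((G.rot ^ k) d) = none := fun k => by
      rw [← hd]; exact (G.site_eq_iff _ _).2 ⟨-k, by simp⟩
    clear he hex
    induction k using Int.induction_on with
    | zero => rfl
    | succ k ih =>
      rw [ih, ← hz _ (hs (k + 1)), add_comm, zpow_one_add]; simp
    | pred k ih => rw [ih, ← hz _ (hs (-k)), sub_eq_add_neg, add_comm, zpow_add]; simp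
  have hpx : ∀ u, p u = p x := by
    intro u
    refine le_antisymm ?_ ?_
    · by_contra! hu
      obtain ⟨m, -, hm⟩ := Finset.exists_max_image Finset.univ p ⟨u, Finset.mem_univ _⟩
      -- Among the maxima of `p` take one farthest from `x`. If it is not a boundary face, curvature
      -- supplies a farther neighbour, where `p` is smaller: distance falls while `p` rises.
      obtain ⟨a, ha, ham⟩ := Finset.exists_max_image (Finset.univ.filter fun a => p a = p m)
        (fun a => G.dual.dist x a) ⟨m, by simp⟩
      simp only [Finset.mem_filter, Finset.mem_univ, true_and, forall_const] at ha ham hm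
      have hna : ¬ G.IsBoundaryFace a := fun h => by
        have := hb a h; have := hm u; linarith
      obtain ⟨v, ⟨-, e, rfl, rfl⟩, hlt⟩ := hc x a hna
      by_cases hv : p (G.face (G.flip e)) = p m
      · exact absurd (ham _ hv) (by omega)
      · have h1 := hp e
        have h2 := lt_of_le_of_ne (hm (G.face (G.flip e))) hv
        have h3 := hw e fun h => by
          have := hw0 (G.flip e); linarith
        unfold grad at h3; omega
    · by_contra! hu
      obtain ⟨m, -, hm⟩ := Finset.exists_min_image Finset.univ p ⟨u, Finset.mem_univ _⟩
      -- Dually, a minimum of `p` nearest to `x`: the first step of a geodesic towards `x` lowers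
      -- the distance but raises `p`.
      obtain ⟨a, ha, ham⟩ := Finset.exists_min_image (Finset.univ.filter fun a => p a = p m)
        (fun a => G.dual.dist x a) ⟨m, by simp⟩
      simp only [Finset.mem_filter, Finset.mem_univ, true_and, forall_const] at ha ham hm
      have hna : x ≠ a := fun h => by
        rw [← h] at ha; have := hm u; linarith
      obtain ⟨W, hW⟩ := dual_connected.exists_walk_length_eq_dist a x
      cases W with
      | nil => exact hna rfl
      | @cons _ v _ h W =>
        have hlt : G.dual.dist x v < G.dual.dist x a := by
          rw [SimpleGraph.dist_comm, SimpleGraph.dist_comm (u := x), ← hW,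
            SimpleGraph.Walk.length_cons]
          exact Nat.lt_succ_of_le (SimpleGraph.dist_le W)
        obtain ⟨-, e, rfl, rfl⟩ := h
        by_cases hv : p (G.face (G.flip e)) = p m
        · exact absurd (ham _ hv) (by omega)
        · have h1 := hp e
          have h2 := lt_of_le_of_ne (hm (G.face (G.flip e))) (Ne.symm hv)
          have h3 := hw (G.flip e) fun h => by
            have := hw0 e; linarith
          rw [grad_flip] at h3
          unfold grad at h3; omega
  -- With `p` constant, `w` agrees on both orientations of each leg, but the increment can be +1 on
  -- only one of them.
  by_contra hd
  have h1 := hw d hd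
  have h2 : w (G.flip d) = 0 := by
    by_contra h
    have := hw _ h
    rw [grad_flip] at this; omega
  have := hp d
  rw [hpx, hpx (G.face (G.flip d)), h2] at this
  exact hd (by linarith)

/-- In a non-positively curved graph the orientation of the legs by the distance from a boundary
face is acyclic. -/
theorem NonpositivelyCurved.exists_last (hc : G.NonpositivelyCurved)
    {x : G.Face} (hx : G.IsBoundaryFace x) {ε : ℤ} (hε : ε = 1 ∨ ε = -1) (W : Set V)
    (hW : W.Nonempty) :
    ∃ v ∈ W, ∀ d, G.site d = some v → G.grad x d = ε → ∀ w ∈ W, G.site (G.flip d) ≠ some w := by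
  classical
  by_contra! hcon
  have hcon' : ∀ v : W, ∃ d, G.site d = some v.1 ∧ G.grad x d = ε ∧
      ∃ w : W, G.site (G.flip d) = some w.1 := fun v => by
    obtain ⟨d, h1, h2, w, hw, h3⟩ := hcon v.1 v.2
    exact ⟨d, h1, h2, ⟨w, hw⟩, h3⟩
  -- Following the chosen darts is a self-map `nx` of a finite set. It permutes its nonempty set of
  -- periodic points, so the darts leaving these carry a unit circulation.
  choose e he1 he2 nx hnx using hcon'
  set P : Finset W := Finset.univ.filter fun v => v ∈ Function.periodicPts nx with hP
  have hbij := Function.bijOn_periodicPts nx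
  obtain ⟨v₀, hv₀⟩ : ∃ v, v ∈ Function.periodicPts nx := by
    obtain ⟨v, hv⟩ := hW
    obtain ⟨m, n, hmn, h⟩ := Finite.exists_ne_map_eq_of_infinite fun n : ℕ => nx^[n] ⟨v, hv⟩
    wlog hlt : m < n generalizing m n
    · exact this n m hmn.symm h.symm (by omega)
    refine ⟨nx^[m] ⟨v, hv⟩, Function.mk_mem_periodicPts (n := n - m) (by omega) ?_⟩
    change nx^[n - m] (nx^[m] ⟨v, hv⟩) = _
    rw [← Function.iterate_add_apply, Nat.sub_add_cancel hlt.le]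
    exact h.symm
  set w : Dart → ℚ := fun d => if ∃ v ∈ P, e v = d then 1 else 0 with hw
  have heinj : Function.Injective e := fun a b h => by
    have := he1 a; rw [h, he1 b] at this
    exact Subtype.ext (Option.some.inj this).symm
  have hwsum : ∀ q : Dart → ℚ, ∑ d, w d * q d = ∑ v ∈ P, q (e v) := fun q => by
    simp only [hw, ite_mul, one_mul, zero_mul]
    rw [← Finset.sum_filter, ← Finset.sum_image (f := q) (g := e) heinj.injOn]
    congr 1; ext d; simp
  have hbal : ∀ s, ∑ d with G.site d = s, (w d - w (G.flip d)) = 0 := fun s => by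
    rw [Finset.sum_sub_distrib, sub_eq_zero, Finset.sum_filter, Finset.sum_filter,
      ← Equiv.sum_comp G.flip (fun d => if G.site d = s then w (G.flip d) else 0)]
    simp only [G.flip_flip]
    have h1 := hwsum fun d => if G.site d = s then 1 else 0
    have h2 := hwsum fun d => if G.site (G.flip d) = s then 1 else 0
    simp only [mul_ite, mul_one, mul_zero] at h1 h2
    rw [h1, h2]
    simp only [he1, hnx]
    refine (Finset.sum_bij (fun a _ => nx a) ?_ ?_ ?_ ?_).symm
    · intro a ha
      simp only [hP, Finset.mem_filter, Finset.mem_univ, true_and] at ha ⊢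
      exact hbij.mapsTo ha
    · intro a ha b hb h
      simp only [hP, Finset.mem_filter, Finset.mem_univ, true_and] at ha hb
      exact hbij.injOn ha hb h
    · intro b hb
      simp only [hP, Finset.mem_filter, Finset.mem_univ, true_and] at hb
      obtain ⟨a, ha, rfl⟩ := hbij.surjOn hb
      exact ⟨a, by simpa [hP] using ha, rfl⟩
    · intros; rfl
  have hw0 : ∀ d, 0 ≤ w d := fun d => by simp only [hw]; split_ifs <;> norm_num
  have hwne : ∀ d, w d ≠ 0 → ∃ v, e v = d := fun d hd => by
    simp only [hw] at hd
    split_ifs at hd with h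
    · obtain ⟨v, -, h⟩ := h; exact ⟨v, h⟩
    · exact absurd rfl hd
  have hwn : ∀ d, G.site d = none → w d = 0 ∧ w (G.flip d) = 0 := fun d hd => by
    constructor
    · by_contra h
      obtain ⟨v, rfl⟩ := hwne _ h
      rw [he1] at hd; exact absurd hd (by simp)
    · by_contra h
      obtain ⟨v, hv⟩ := hwne _ h
      have := hnx v
      rw [hv, G.flip_flip, hd] at this
      exact absurd this (by simp)
  have hwv : w (e v₀) = 1 := if_pos ⟨v₀, by simpa [hP] using hv₀, rfl⟩
  rcases hε with rfl | rfl
  · have := hc.circulation_eq_zero hx w hw0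
      (fun d hd => by obtain ⟨v, rfl⟩ := hwne d hd; exact he2 v) hwn hbal (e v₀)
    rw [hwv] at this; exact one_ne_zero this
  -- For increment -1 the reversed circulation is used.
  · have := hc.circulation_eq_zero hx (fun d => w (G.flip d)) (fun d => hw0 _)
      (fun d hd => by
        obtain ⟨v, hv⟩ := hwne _ hd
        have := he2 v
        rw [hv, grad_flip] at this; omega)
      (fun d hd => by rw [G.flip_flip]; exact (hwn d hd).symm)
      (fun s => by
        have := hbal s
        rw [Finset.sum_sub_distrib] at this ⊢
        simp only [G.flip_flip]; linarith) (G.flip (e v₀))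
    simp only [G.flip_flip] at this
    rw [hwv] at this; exact one_ne_zero this

end DiskGraph

/-! ### Dual paths, intervals and minimal cuts. -/

namespace DiskGraph

/-- Applied to increments of distance along a path: a path no longer than the distance it gains
rises at each step. -/
theorem eq_one_of_length_le_sum {α : Type*} {γ : List α} {g : α → ℤ} (hg : ∀ d, g d ≤ 1)
    (h : (γ.length : ℤ) ≤ (γ.map g).sum) : ∀ d ∈ γ, g d = 1 := by
  have hle : ∀ γ : List α, (γ.map g).sum ≤ γ.length := fun γ => by
    induction γ with
    | nil => simp
    | cons e γ ih => have := hg e; simp; omega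
  induction γ with
  | nil => simp
  | cons e γ ih =>
    have h1 := hle γ
    have h2 := hg e
    simp only [List.length_cons, List.map_cons, List.sum_cons, Nat.cast_add, Nat.cast_one] at h
    intro d hd
    rcases List.mem_cons.1 hd with rfl | hd
    · omega
    · exact ih (by omega) d hd

variable {V Dart : Type*} [Fintype V] [Fintype Dart] {G : DiskGraph V Dart}

theorem IsDualPath.sum_map {K : Type*} [AddCommGroup K] (φ : G.Face → K) {γ : List Dart} :
    ∀ {x y : G.Face}, G.IsDualPath x γ y →
      (γ.map fun d => φ (G.face d) - φ (G.face (G.flip d))).sum = φ y - φ x := by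
  induction γ with
  | nil => rintro x _ rfl; simp
  | cons d γ ih =>
    rintro x y ⟨rfl, h⟩
    rw [List.map_cons, List.sum_cons, ih h]; abel

/-- The boundary of a path is its end minus its start, obtained by telescoping the indicator of `u`.
As no dart repeats, the indicator of `γ` is the chain of the path. -/
theorem IsDualPath.sum_face {K : Type*} [Field K] [DecidableEq G.Face] [DecidableEq Dart]
    {γ : List Dart} {x y : G.Face} (h : G.IsDualPath x γ y) (hγ : γ.Nodup) (u : G.Face) :
    ∑ d with G.face d = u, ((if d ∈ γ then (1 : K) else 0) - if G.flip d ∈ γ then 1 else 0)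
      = (if y = u then 1 else 0) - if x = u then 1 else 0 := by
  rw [← h.sum_map fun v => if v = u then (1 : K) else 0, ← List.sum_toFinset _ hγ,
    Finset.sum_sub_distrib, Finset.sum_sub_distrib, Finset.sum_filter, Finset.sum_filter,
    ← Equiv.sum_comp G.flip (fun d => if G.face d = u then if G.flip d ∈ γ then (1 : K) else 0 else 0)]
  simp only [G.flip_flip, ← List.mem_toFinset, ← Finset.sum_filter, Finset.filter_filter]
  congr 1
  · simp only [and_comm, ← Finset.filter_filter, Finset.filter_univ_mem]
  · simp only [and_comm, ← Finset.filter_filter, Finset.filter_univ_mem]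

theorem exists_isDualPath_of_walk {x y : G.Face} (w : G.dual.Walk x y) :
    ∃ γ, G.IsDualPath x γ y ∧ γ.length = w.length := by
  induction w with
  | nil => exact ⟨[], rfl, rfl⟩
  | cons h w ih =>
    obtain ⟨γ, hγ, hl⟩ := ih
    have h' := h
    obtain ⟨-, d, hu, hv⟩ := h'
    refine ⟨G.flip d :: γ, ⟨by rw [G.flip_flip, hu], by rwa [hv]⟩, by simp [hl]⟩

/-- The distance from `x` increases strictly along the path, so no dart can recur. -/
theorem IsDualPath.nodup_of_grad {x z : G.Face} {γ : List Dart} : ∀ {y : G.Face},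
    G.IsDualPath y γ z → (∀ d ∈ γ, G.grad x d = 1) →
      γ.Nodup ∧ ∀ d ∈ γ, G.dual.dist x y < G.dual.dist x (G.face d) := by
  induction γ with
  | nil => simp
  | cons e γ ih =>
    rintro y ⟨rfl, h⟩ hγ
    obtain ⟨h1, h2⟩ := ih h fun d hd => hγ d (List.mem_cons_of_mem _ hd)
    have he := hγ e List.mem_cons_self
    unfold grad at he
    refine ⟨List.nodup_cons.2 ⟨fun hmem => lt_irrefl _ (h2 e hmem), h1⟩, fun d hd => ?_⟩
    rcases List.mem_cons.1 hd with rfl | hd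
    · omega
    · have := h2 d hd; omega

theorem IsDualPath.sum_grad {x y z : G.Face} {γ : List Dart} (h : G.IsDualPath y γ z) :
    (γ.map (G.grad x)).sum = (G.dual.dist x z : ℤ) - G.dual.dist x y :=
  h.sum_map fun u => (G.dual.dist x u : ℤ)

theorem EvenDegrees.grad_le_one (hG : G.EvenDegrees) (x : G.Face) (d : Dart) : G.grad x d ≤ 1 := by
  rcases hG.grad_eq x d with h | h <;> omega

theorem EvenDegrees.exists_geodesic (hG : G.EvenDegrees) (x y : G.Face) :
    ∃ γ, G.IsDualPath x γ y ∧ γ.length = G.dual.dist x y ∧ γ.Nodup := by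
  obtain ⟨w, hw⟩ := dual_connected.exists_walk_length_eq_dist x y
  obtain ⟨γ, hγ, hl⟩ := exists_isDualPath_of_walk w
  refine ⟨γ, hγ, hl.trans hw, (hγ.nodup_of_grad (x := x) ?_).1⟩
  refine eq_one_of_length_le_sum (hG.grad_le_one x) ?_
  rw [hγ.sum_grad, hl, hw]; simp

namespace Interval

variable (A : G.Interval)

/-- The legs of an interval in their order. -/
def legList : List Dart := (List.range A.length).map fun i => (G.rot ^ i) A.start

theorem mem_legList {d : Dart} : d ∈ A.legList ↔ d ∈ A.legs := by
  simp [legList, legs, eq_comm]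

theorem isDualPath_legList : G.IsDualPath A.first A.legList A.last := by
  have h : ∀ (n : ℕ) (e : Dart), G.IsDualPath (G.face (G.rot⁻¹ e))
      ((List.range n).map fun i => (G.rot ^ i) e) (G.face ((G.rot ^ n) (G.rot⁻¹ e))) := by
    intro n
    induction n with
    | zero => intro e; rfl
    | succ n ih =>
      intro e
      rw [List.range_succ_eq_map, List.map_cons, List.map_map]
      refine ⟨G.face_flip e, ?_⟩
      have := ih (G.rot e)
      simpa [pow_succ, Function.comp_def] using this
  exact h A.length A.start

theorem site_pow (i : ℕ) : G.site ((G.rot ^ i) A.start) = none := by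
  rw [← A.start_boundary]
  exact (G.site_eq_iff _ _).2 ⟨-i, by simp⟩

theorem site_of_mem {d : Dart} (h : d ∈ A.legs) : G.site d = none := by
  obtain ⟨i, -, rfl⟩ := h
  exact A.site_pow i

theorem nodup_legList : A.legList.Nodup := by
  refine List.Nodup.map_on ?_ List.nodup_range
  intro i hi j hj h
  rw [List.mem_range] at hi hj
  wlog hij : i < j generalizing i j
  · rcases lt_trichotomy i j with h' | h' | h'
    · exact absurd h' hij
    · exact h'
    · exact (this j hj i hi h.symm h').symm
  exfalso
  -- A repetition closes the boundary cycle after `j - i < A.length` steps, leaving fewer boundary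
  -- legs than the interval has.
  have hk : (G.rot ^ (j - i)) A.start = A.start := by
    apply (G.rot ^ i).injective
    rw [← Equiv.Perm.mul_apply, ← pow_add, Nat.add_sub_cancel' hij.le, h]
  set k := j - i with hk'
  have hkpos : 0 < k := by omega
  have hsurj : Function.Surjective fun m : Fin k =>
      (⟨(G.rot ^ m.1) A.start, A.site_pow m⟩ : {d // G.site d = none}) := by
    rintro ⟨d, hd⟩
    obtain ⟨n, rfl⟩ := (G.site_eq_iff A.start d).1 (A.start_boundary.trans hd.symm)
    have hn := Int.emod_nonneg n (b := k) (by omega)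
    have hn' := Int.emod_lt_of_pos n (b := k) (by omega)
    refine ⟨⟨(n % k).toNat, by omega⟩, Subtype.ext ?_⟩
    have h1 : ∀ q : ℤ, (G.rot ^ ((k : ℤ) * q)) A.start = A.start := fun q => by
      rw [zpow_mul]
      exact Function.IsFixedPt.perm_zpow (e := G.rot ^ (k : ℤ)) (by simpa using! hk) q
    change (G.rot ^ (n % k).toNat) A.start = (G.rot ^ n) A.start
    conv_rhs => rw [← Int.emod_add_mul_ediv n k, zpow_add, Equiv.Perm.mul_apply, h1]
    rw [← zpow_natCast]
    rw [Int.toNat_of_nonneg hn]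
  have := Nat.card_le_card_of_surjective _ hsurj
  rw [Nat.card_fin] at this
  have := A.length_le
  omega

end Interval

theorem mem_side_iff {A : G.Interval} {S : Set V} {d : Dart} :
    d ∈ G.side S A.legs ↔ d ∈ A.legs ∨ ∃ v ∈ S, G.site d = some v :=
  or_congr_left ⟨fun h => h.2, fun h => ⟨A.site_of_mem h, h⟩⟩

open Classical in
/-- The total increment of the distance across the cut legs only depends on the interval. -/
theorem sum_grad_cut (A : G.Interval) (S : Set V) (x : G.Face) :
    ∑ d with d ∈ G.side S A.legs ∧ G.flip d ∉ G.side S A.legs, G.grad x d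
      = (G.dual.dist x A.last : ℤ) - G.dual.dist x A.first := by
  -- Over all darts of the side, the vertices contribute zero by conservation and the interval
  -- telescopes; uncut legs then cancel under `flip`.
  have h1 : ∑ d with d ∈ G.side S A.legs, G.grad x d
      = (G.dual.dist x A.last : ℤ) - G.dual.dist x A.first := by
    rw [← A.isDualPath_legList.sum_grad, ← List.sum_toFinset _ A.nodup_legList]
    have hdis : Disjoint A.legList.toFinset
        (Finset.univ.filter fun d => ∃ v ∈ S, G.site d = some v) := by
      rw [Finset.disjoint_left]
      intro d hd hd'
      simp only [List.mem_toFinset, A.mem_legList, Finset.mem_filter, Finset.mem_univ,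
        true_and] at hd hd'
      obtain ⟨v, -, hv⟩ := hd'
      rw [A.site_of_mem hd] at hv
      exact absurd hv (by simp)
    have hun : (Finset.univ.filter fun d => d ∈ G.side S A.legs) = A.legList.toFinset ∪
        (Finset.univ.filter fun d => ∃ v ∈ S, G.site d = some v) := by
      ext d
      simp [mem_side_iff, A.mem_legList]
    rw [hun, Finset.sum_union hdis]
    have hz : ∑ d with ∃ v ∈ S, G.site d = some v, G.grad x d = 0 := by
      rw [← Finset.sum_fiberwise (g := G.site)]
      refine Finset.sum_eq_zero fun s _ => ?_
      rw [Finset.filter_filter]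
      by_cases hs : ∃ v ∈ S, s = some v
      · rw [← DiskGraph.sum_grad x s]
        refine Finset.sum_congr (Finset.filter_congr fun d _ => ?_) fun _ _ => rfl
        exact ⟨fun h => h.2, fun h => ⟨by rwa [h], h⟩⟩
      · refine Finset.sum_eq_zero fun d hd => ?_
        rw [Finset.mem_filter] at hd
        obtain ⟨-, h, rfl⟩ := hd
        exact absurd h hs
    rw [hz, add_zero]
  rw [← h1, ← Finset.sum_filter_add_sum_filter_not (Finset.univ.filter fun d => d ∈ G.side S A.legs)
    (fun d => G.flip d ∈ G.side S A.legs), Finset.filter_filter, Finset.filter_filter]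
  have hz : ∑ d with d ∈ G.side S A.legs ∧ G.flip d ∈ G.side S A.legs, G.grad x d = 0 :=
    Finset.sum_involution (fun d _ => G.flip d) (fun d _ => by rw [grad_flip]; ring)
      (fun d _ _ => G.flip_ne d)
      (fun d hd => by
        simp only [Finset.mem_filter, Finset.mem_univ, true_and, G.flip_flip] at hd ⊢
        exact hd.symm)
      (fun d _ => G.flip_flip d)
  rw [hz, zero_add]

theorem Cut.card_cutLeg {A : G.Interval} (γ : G.Cut A) :
    Nat.card (G.CutLeg γ.region A.legs) = γ.path.length := by
  classical
  rw [← List.toFinset_card_of_nodup γ.nodup]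
  exact Nat.subtype_card _ fun d => by rw [List.mem_toFinset, γ.mem_path]

/-- A shortest path between the two ends of an interval is a cut. -/
theorem EvenDegrees.exists_geodesic_cut (hG : G.EvenDegrees) (A : G.Interval) :
    ∃ γ : G.Cut A, Nat.card (G.CutLeg γ.region A.legs) = G.dual.dist A.first A.last := by
  classical
  obtain ⟨p, hp, hpl, hpn⟩ := hG.exists_geodesic A.first A.last
  -- The geodesic minus the path along the interval is a closed dual chain, hence the coboundary of
  -- a site potential.
  set z : Dart → ℚ := fun d =>
    ((if d ∈ p then 1 else 0) - if G.flip d ∈ p then 1 else 0)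
      - ((if d ∈ A.legList then 1 else 0) - if G.flip d ∈ A.legList then 1 else 0) with hz
  obtain ⟨s, hs⟩ := G.exists_site_potential z (fun d => by simp only [hz, G.flip_flip]; ring)
    (fun u => by
      rw [hz, Finset.sum_sub_distrib, hp.sum_face hpn,
        A.isDualPath_legList.sum_face A.nodup_legList, sub_self])
  -- Normalized to vanish at the boundary point and raised by one on the interval, the potential has
  -- exactly the geodesic as its coboundary. Its superlevel set at 1 is the side of the cut.
  set q : Dart → ℚ := fun d => s (G.site d) - s none + if d ∈ A.legList then 1 else 0 with hq
  have hqp : ∀ d, q d - q (G.flip d) = (if d ∈ p then 1 else 0) - if G.flip d ∈ p then 1 else 0 :=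
    fun d => by
      have := hs d
      simp only [hz, hq] at this ⊢
      linarith
  set S : Set V := {v | 1 ≤ s (some v) - s none} with hS
  have hside : ∀ d, d ∈ G.side S A.legs ↔ 1 ≤ q d := fun d => by
    rw [mem_side_iff, ← A.mem_legList]
    simp only [hq, hS, Set.mem_ofPred_eq]
    by_cases hd : d ∈ A.legList
    · simp [hd, A.site_of_mem (A.mem_legList.1 hd)]
    · simp only [hd, false_or, if_false, add_zero]
      rcases hsd : G.site d with _ | v
      · simp
      · simp
  set C := Finset.univ.filter fun d => d ∈ G.side S A.legs ∧ G.flip d ∉ G.side S A.legs with hC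
  have hCp : C ⊆ p.toFinset := fun d hd => by
    simp only [hC, Finset.mem_filter, Finset.mem_univ, true_and, hside, not_le] at hd
    have := hqp d
    rw [List.mem_toFinset]
    by_contra h
    rw [if_neg h] at this
    split_ifs at this <;> linarith
  -- The increments over `C` sum to the length of the geodesic and each is at most 1, so no leg of
  -- the geodesic is missing from `C`.
  have hcard : p.toFinset.card ≤ C.card := by
    have h1 := sum_grad_cut A S A.first
    have h2 : ∑ d ∈ C, G.grad A.first d ≤ ∑ d ∈ C, 1 :=
      Finset.sum_le_sum fun d _ => hG.grad_le_one _ d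
    rw [h1] at h2
    rw [List.toFinset_card_of_nodup hpn, hpl]
    simp at h2
    exact h2
  have heq := Finset.eq_of_subset_of_card_le hCp hcard
  refine ⟨⟨S, p, hp, hpn, fun d => ?_⟩, ?_⟩
  · rw [← List.mem_toFinset, ← heq, hC]; simp
  · rw [Cut.card_cutLeg, hpl]

/-- Across a minimal cut the distance from the first end of the interval increases. -/
theorem EvenDegrees.grad_eq_one (hG : G.EvenDegrees) {A : G.Interval} (γ : G.Cut A)
    (hγ : Nat.card (G.CutLeg γ.region A.legs) ≤ G.dual.dist A.first A.last) {d : Dart}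
    (hd : d ∈ G.side γ.region A.legs) (hd' : G.flip d ∉ G.side γ.region A.legs) :
    G.grad A.first d = 1 := by
  refine eq_one_of_length_le_sum (hG.grad_le_one _) ?_ d ((γ.mem_path d).2 ⟨hd, hd'⟩)
  rw [γ.isDualPath.sum_grad, ← γ.card_cutLeg]
  simpa using hγ

end DiskGraph

/-! ### Contraction of a circuit of isometries with its conjugate. -/

section Circuit

variable {L ι α : Type*} [DecidableEq L]

/-- The configuration with given values on `O` and off `O`. -/
def glue (O : Finset L) (o : {l // l ∈ O} → α) (x : {l // l ∉ O} → α) : L → α :=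
  fun l => if h : l ∈ O then o ⟨l, h⟩ else x ⟨l, h⟩

theorem glue_of_mem {O : Finset L} (o : {l // l ∈ O} → α) (x : {l // l ∉ O} → α) {l : L}
    (h : l ∈ O) : glue O o x l = o ⟨l, h⟩ := dif_pos h

theorem glue_of_notMem {O : Finset L} (o : {l // l ∈ O} → α) (x : {l // l ∉ O} → α) {l : L}
    (h : l ∉ O) : glue O o x l = x ⟨l, h⟩ := dif_neg h

theorem sum_eq_sum_glue [Fintype L] [Fintype α] (O : Finset L) (f : (L → α) → ℂ) :
    ∑ x, f x = ∑ o, ∑ x', f (glue O o x') := by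
  rw [← Fintype.sum_prod_type']
  exact Fintype.sum_equiv (Equiv.piEquivPiSubtypeProd (· ∈ O) fun _ => α) _ _ fun x => by
    congr 1
    ext l
    simp [glue, Equiv.piEquivPiSubtypeProd]

theorem sum_diagonal [Fintype L] [Fintype α] [DecidableEq α] (O : Finset L) (f : (L → α) → (L → α) → ℂ) :
    ∑ x, ∑ y, (if ∀ l ∈ O, x l = y l then f x y else 0)
      = ∑ x', ∑ y', ∑ o, f (glue O o x') (glue O o y') := by
  have h : ∀ (o o' : {l // l ∈ O} → α) x' y',
      (if ∀ l ∈ O, glue O o x' l = glue O o' y' l then f (glue O o x') (glue O o' y') else 0)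
        = if o = o' then f (glue O o x') (glue O o' y') else 0 := fun o o' x' y' => by
    refine if_congr ⟨fun h => ?_, fun h l hl => ?_⟩ rfl rfl
    · ext l
      have := h l.1 l.2
      rwa [glue_of_mem _ _ l.2, glue_of_mem _ _ l.2] at this
    · rw [h, glue_of_mem _ _ hl, glue_of_mem _ _ hl]
  rw [sum_eq_sum_glue O]
  simp_rw [sum_eq_sum_glue O (fun y => if _ then f _ y else 0), h]
  rw [Finset.sum_comm]
  refine Finset.sum_congr rfl fun x' _ => ?_
  rw [Finset.sum_comm' (t' := Finset.univ) (s' := fun _ => Finset.univ) (by simp),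
    Finset.sum_congr rfl fun o' _ => Finset.sum_comm]
  rw [Finset.sum_comm]
  refine Finset.sum_congr rfl fun y' _ => ?_
  rw [Finset.sum_congr rfl fun o' _ => Finset.sum_ite_eq' _ _ _]
  simp

/-- A circuit of isometries. Every gate `t v` is an isometry from its input legs `inn v` to its
output legs `out v`, and the gates can be removed one after the other, beginning with a last one.
The doubled circuit, closed along `A` and all legs that are not inputs, evaluates to the doubled
wires. -/
theorem circuit_sum [Fintype L] [Fintype α] [DecidableEq α] [DecidableEq ι] [Nonempty α]
    (inn out : ι → Finset L) (t : ι → (L → α) → ℂ)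
    (hdep : ∀ v x y, (∀ l, l ∈ inn v ∨ l ∈ out v → x l = y l) → t v x = t v y)
    (hiso : ∀ v (x y : {l // l ∉ out v} → α),
      ∑ o, conj (t v (glue (out v) o x)) * t v (glue (out v) o y)
        = if ∀ l, l.1 ∈ inn v → x l = y l then 1 else 0)
    (hinn : ∀ v w, v ≠ w → Disjoint (inn v) (inn w))
    (hout : ∀ v w, v ≠ w → Disjoint (out v) (out w))
    (hlast : ∀ W : Finset ι, W.Nonempty → ∃ v ∈ W, ∀ w ∈ W, Disjoint (out v) (inn w))
    (A : Finset L) (B : (L → α) → (L → α) → ℂ)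
    (hB : ∀ v x x' y y', (∀ l ∉ out v, x l = x' l) → (∀ l ∉ out v, y l = y' l) → B x y = B x' y')
    (W : Finset ι) :
    (∑ x, ∑ y, if ∀ l, (l ∈ A ∨ ∀ w ∈ W, l ∉ inn w) → x l = y l then
        B x y * ∏ w ∈ W, (conj (t w x) * t w y) else 0) * (Fintype.card α : ℂ) ^ (∑ v ∈ W, (out v).card)
      = ∑ x, B x x := by
  induction hn : W.card generalizing W with
  | zero =>
    rw [Finset.card_eq_zero] at hn
    subst hn
    simp [← funext_iff]
  | succ n ih =>
    obtain ⟨v, hvW, hv⟩ := hlast W (Finset.card_pos.1 (by omega))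
    rw [← ih (W.erase v) (by rw [Finset.card_erase_of_mem hvW, hn]; rfl),
      ← Finset.add_sum_erase _ _ hvW, pow_add, ← mul_assoc]
    congr 1
    set O := out v with hO
    obtain ⟨a₀⟩ := ‹Nonempty α›
    set o₀ : {l // l ∈ O} → α := fun _ => a₀
    set F : (L → α) → (L → α) → ℂ := fun x y => B x y * ∏ w ∈ W.erase v, (conj (t w x) * t w y)
    -- The outputs of a last gate meet no remaining gate. Once it is removed they are summed freely,
    -- which accounts for the factor `card α ^ O.card`.
    have hF : ∀ o x y, F (glue O o x) (glue O o y) = F (glue O o₀ x) (glue O o₀ y) := by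
      intro o x y
      have hg : ∀ (x : {l // l ∉ O} → α), ∀ l ∉ O, glue O o x l = glue O o₀ x l := fun x l hl => by
        rw [glue_of_notMem _ _ hl, glue_of_notMem _ _ hl]
      have ht : ∀ (x : {l // l ∉ O} → α), ∀ w ∈ W.erase v, t w (glue O o x) = t w (glue O o₀ x) := by
        intro x w hw
        refine hdep w _ _ fun l hl => hg x l fun hlO => ?_
        rcases hl with hl | hl
        · exact Finset.disjoint_left.1 (hv w (Finset.mem_of_mem_erase hw)) hlO hl
        · exact Finset.disjoint_left.1 (hout v w (Finset.ne_of_mem_erase hw).symm) hlO hl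
      change B _ _ * _ = B _ _ * _
      rw [hB v _ _ _ _ (hg x) (hg y)]
      congr 1
      exact Finset.prod_congr rfl fun w hw => by rw [ht x w hw, ht y w hw]
    set R : L → Prop := fun l => l ∈ A ∨ ∀ w ∈ W, l ∉ inn w with hR
    have hRO : ∀ l ∈ O, R l := fun l hl =>
      Or.inr fun w hw => Finset.disjoint_left.1 (hv w hw) hl
    -- Removing the gate identifies its input legs in the two copies, which is precisely the delta
    -- produced by its isometry property.
    have hR' : ∀ l, (l ∈ A ∨ ∀ w ∈ W.erase v, l ∉ inn w) ↔ (R l ∨ l ∈ inn v) := by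
      intro l
      constructor
      · rintro (h | h)
        · exact Or.inl (Or.inl h)
        · by_cases hl : l ∈ inn v
          · exact Or.inr hl
          · refine Or.inl (Or.inr fun w hw => ?_)
            by_cases hwv : w = v
            · rwa [hwv]
            · exact h w (Finset.mem_erase.2 ⟨hwv, hw⟩)
      · rintro ((h | h) | h)
        · exact Or.inl h
        · exact Or.inr fun w hw => h w (Finset.mem_of_mem_erase hw)
        · exact Or.inr fun w hw => Finset.disjoint_left.1 (hinn v w (Finset.ne_of_mem_erase hw).symm) h
    classical
    have hsplit : ∀ (Q : L → Prop), (∀ l ∈ O, Q l) → ∀ f : (L → α) → (L → α) → ℂ,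
        ∑ x, ∑ y, (if ∀ l, Q l → x l = y l then f x y else 0)
          = ∑ x', ∑ y', ∑ o, if ∀ l : {l // l ∉ O}, Q l.1 → x' l = y' l then
              f (glue O o x') (glue O o y') else 0 := by
      intro Q hQ f
      have h1 : ∀ x y : L → α, (if ∀ l, Q l → x l = y l then f x y else 0)
          = if ∀ l ∈ O, x l = y l then
            (if ∀ l : {l // l ∉ O}, Q l.1 → x l.1 = y l.1 then f x y else 0) else 0 := by
        intro x y
        rw [← ite_and]
        refine if_congr ⟨fun h => ⟨fun l hl => h l (hQ l hl), fun l hl => h l hl⟩,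
          fun h l hl => ?_⟩ rfl rfl
        by_cases hlO : l ∈ O
        · exact h.1 l hlO
        · exact h.2 ⟨l, hlO⟩ hl
      simp_rw [h1]
      rw [sum_diagonal]
      refine Finset.sum_congr rfl fun x' _ => Finset.sum_congr rfl fun y' _ =>
        Finset.sum_congr rfl fun o _ => if_congr ?_ rfl rfl
      refine forall_congr' fun l => ?_
      rw [glue_of_notMem _ _ l.2, glue_of_notMem _ _ l.2]
    have hL := hsplit R hRO fun x y => B x y * ∏ w ∈ W, (conj (t w x) * t w y)
    have hRt := hsplit (fun l => R l ∨ l ∈ inn v) (fun l hl => Or.inl (hRO l hl)) F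
    simp only [hR']
    refine Eq.trans ?_ (Eq.trans hRt.symm (by congr!))
    refine (congrArg (· * _) (Eq.trans (by congr!) hL)).trans ?_
    rw [Finset.sum_mul]
    refine Finset.sum_congr rfl fun x' _ => ?_
    rw [Finset.sum_mul]
    refine Finset.sum_congr rfl fun y' _ => ?_
    have h1 : ∀ o, B (glue O o x') (glue O o y') *
        ∏ w ∈ W, (conj (t w (glue O o x')) * t w (glue O o y'))
          = F (glue O o₀ x') (glue O o₀ y') *
            (conj (t v (glue O o x')) * t v (glue O o y')) := fun o => by
      rw [← hF o, ← Finset.mul_prod_erase _ _ hvW]; ring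
    simp only [h1, hF]
    have hcard : (Fintype.card α : ℂ) ^ O.card = Fintype.card ({l // l ∈ O} → α) := by simp
    rw [Finset.sum_const, Finset.card_univ, nsmul_eq_mul, hcard, mul_comm]
    congr 1
    by_cases hc : ∀ l : {l // l ∉ O}, R l.1 → x' l = y' l
    · simp only [if_pos hc]
      rw [← Finset.mul_sum, hiso, mul_ite, mul_one, mul_zero]
      exact if_congr ⟨fun h l hl => hl.elim (hc l) (h l), fun h l hl => h l (Or.inr hl)⟩ rfl rfl
    · simp only [if_neg hc, Finset.sum_const_zero]
      rw [if_neg fun h => hc fun l hl => h l (Or.inl hl)]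

end Circuit

/-! ### From oriented networks to isometries. -/

/-- A matrix whose columns are orthogonal and of equal positive norm is an isometry up to scale. -/
theorem isIsometryUpToScale_of_conjTranspose_mul {m n : Type*} [Fintype m] [Fintype n]
    [DecidableEq n] (M : Matrix m n ℂ) {r : ℝ} (hr : 0 < r) (h : Mᴴ * M = (r : ℂ) • 1) :
    IsIsometryUpToScale M := by
  refine ⟨(Real.sqrt r)⁻¹, inv_pos.2 (Real.sqrt_pos.2 hr), ?_⟩
  rw [Matrix.conjTranspose_smul, Matrix.smul_mul, Matrix.mul_smul, h, smul_smul, smul_smul]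
  have : star (((Real.sqrt r)⁻¹ : ℝ) : ℂ) * (((Real.sqrt r)⁻¹ : ℝ) : ℂ) * (r : ℂ) = 1 := by
    rw [Complex.star_def, Complex.conj_ofReal, ← Complex.ofReal_mul, ← Complex.ofReal_mul,
      ← mul_inv, Real.mul_self_sqrt hr.le, inv_mul_cancel₀ hr.ne', Complex.ofReal_one]
  rw [this, one_smul]
  congr!

theorem card_comp_eq {C L α : Type*} [Fintype C] [Fintype L] [Fintype α] [DecidableEq α] [DecidableEq L]
    (q : C → L) (hq : Function.Injective q) (k : C → α) :
    (Finset.univ.filter fun x : L → α => ∀ c, x (q c) = k c).card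
      = Fintype.card α ^ (Fintype.card L - Fintype.card C) := by
  classical
  have h : (Finset.univ.filter fun x : L → α => ∀ c, x (q c) = k c)
      = Fintype.piFinset fun l =>
        if h : ∃ c, q c = l then {k h.choose} else (Finset.univ : Finset α) := by
    ext x
    simp only [Finset.mem_filter, Finset.mem_univ, true_and, Fintype.mem_piFinset]
    constructor
    · intro h l
      split_ifs with hl
      · rw [Finset.mem_singleton, ← h, hl.choose_spec]
      · exact Finset.mem_univ _
    · intro h c
      have := h (q c)
      have hl : ∃ c', q c' = q c := ⟨c, rfl⟩
      rw [dif_pos hl, Finset.mem_singleton] at this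
      rw [this, hq hl.choose_spec]
  rw [h, Fintype.card_piFinset]
  have h2 : ∀ l, (if h : ∃ c, q c = l then {k h.choose} else (Finset.univ : Finset α)).card
      = if l ∈ Finset.univ.image q then 1 else Fintype.card α := fun l => by
    by_cases hl : ∃ c, q c = l
    · rw [dif_pos hl, if_pos (by simpa using hl), Finset.card_singleton]
    · rw [dif_neg hl, if_neg (by simpa using hl), Finset.card_univ]
  rw [Finset.prod_congr rfl fun l _ => h2 l, Finset.prod_ite, Finset.prod_const_one, one_mul,
    Finset.prod_const]
  congr 1
  rw [← Finset.card_image_of_injective Finset.univ hq |>.trans Finset.card_univ,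
    ← Finset.card_compl]
  congr 1
  ext l; simp

/-- Puts an entry of $M^\dagger M$ into the form of a doubled circuit: summing over the boundary
values identifies the two copies there. -/
theorem sum_conj_mul_restrict {L α I : Type*} [Fintype L] [Fintype α] [Fintype I] [DecidableEq α]
    [DecidableEq L] [DecidableEq I]
    (b : I → L) (P Q : (L → α) → Prop) [DecidablePred P] [DecidablePred Q] (f : (L → α) → ℂ) :
    ∑ a : I → α, conj (∑ x, if (∀ d, x (b d) = a d) ∧ P x then f x else 0)
        * (∑ y, if (∀ d, y (b d) = a d) ∧ Q y then f y else 0)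
      = ∑ x, ∑ y, if ∀ d, x (b d) = y (b d) then
          (if P x ∧ Q y then 1 else 0) * (conj (f x) * f y) else 0 := by
  simp_rw [map_sum, Finset.sum_mul_sum]
  rw [Finset.sum_comm]
  refine Finset.sum_congr rfl fun x _ => ?_
  rw [Finset.sum_comm]
  refine Finset.sum_congr rfl fun y _ => ?_
  rw [Finset.sum_eq_single (fun d => x (b d))]
  · by_cases hP : P x <;> by_cases hQ : Q y <;> simp [hP, hQ, eq_comm]
  · intro a _ ha
    rw [if_neg, map_zero, zero_mul]
    exact fun h => ha (funext fun d => (h.1 d).symm)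
  · simp

namespace HaPPYNetwork

variable {V Dart : Type*} [Fintype V] [Fintype Dart] {D : ℕ} (N : HaPPYNetwork V Dart D)

/-- The legs with at least one end on a side, uncut legs being represented by both ends. -/
abbrev SideLeg (S : Set V) (A : Set Dart) : Type _ :=
  Quot fun d e : N.side S A => N.flip d.1 = e.1

open Classical in
noncomputable instance (S : Set V) (A : Set Dart) : Fintype (N.SideLeg S A) := Fintype.ofFinite _

variable {N} {S : Set V} {A : Set Dart}

/-- The unordered pair of ends of a leg is an invariant of the class and determines it. -/
theorem sideLeg_eq {d e : N.side S A} (h : (Quot.mk _ d : N.SideLeg S A) = Quot.mk _ e) :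
    d = e ∨ N.flip d.1 = e.1 := by
  have hs : ∀ a b : N.side S A, N.flip a.1 = b.1 →
      ({a.1, N.flip a.1} : Set Dart) = {b.1, N.flip b.1} := fun a b h => by
    rw [← h, N.flip_flip, Set.pair_comm]
  have h1 := congrArg (Quot.lift (fun d : N.side S A => ({d.1, N.flip d.1} : Set Dart)) hs) h
  have h2 : e.1 ∈ ({d.1, N.flip d.1} : Set Dart) := by
    change ({d.1, N.flip d.1} : Set Dart) = {e.1, N.flip e.1} at h1
    rw [h1]; exact Or.inl rfl
  rcases h2 with h | h
  · exact Or.inl (Subtype.ext h.symm)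
  · exact Or.inr h.symm

-- Dart configurations that agree along uncut legs are those that descend to legs, which removes the
-- contraction constraint.
open Classical in
theorem blockMap_apply (a : N.BoundaryLeg A → Fin D) (k : N.CutLeg S A → Fin D) :
    N.blockMap S A a k = ∑ x : N.SideLeg S A → Fin D,
      if (∀ d : N.BoundaryLeg A, x (Quot.mk _ ⟨d.1, Or.inl d.2⟩) = a d) ∧
        (∀ d : N.CutLeg S A, x (Quot.mk _ ⟨d.1, d.2.1⟩) = k d)
      then ∏ v : S, N.tensor v fun d => x (Quot.mk _ ⟨d.1, Or.inr ⟨v, v.2, d.2⟩⟩)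
      else 0 := by
  unfold blockMap
  simp_rw [← and_assoc (c := ∀ d e : N.side S A, _)]
  simp_rw [and_comm (b := ∀ d e : N.side S A, _), ite_and]
  rw [← Finset.sum_filter]
  refine (Finset.sum_bij (fun x _ => fun d => x (Quot.mk _ d)) ?_ ?_ ?_ ?_).symm
  · intro x _
    simp only [Finset.mem_filter, Finset.mem_univ, true_and]
    exact fun d e h => congrArg x (Quot.sound h)
  · intro x _ y _ h
    ext l
    induction l using Quot.ind with
    | mk d => exact congrArg Fin.val (congrFun h d)
  · intro h hh
    simp only [Finset.mem_filter, Finset.mem_univ, true_and] at hh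
    exact ⟨fun l => Quot.lift h hh l, Finset.mem_univ _, rfl⟩
  · intro x _
    rfl

open Classical in
/-- The tensors of a block, as functions of the configuration of its legs. -/
theorem sum_conj_mul_tensorMatrix {ι L : Type*} [Fintype ι] [DecidableEq L] (T : (ι → Fin D) → ℂ)
    (hT : IsPerfectTensor T) (K : Finset ι) (hK : 2 * K.card = Fintype.card ι) (O : Finset L)
    (q : ι → L) (hq : ∀ i, q i ∈ O ↔ i ∉ K) (hinj : ∀ i j, i ∉ K → j ∉ K → q i = q j → i = j)
    (hO : ∀ l ∈ O, ∃ i, q i = l) (x y : {l // l ∉ O} → Fin D) :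
    ∑ o, conj (T fun i => glue O o x (q i)) * T (fun i => glue O o y (q i))
      = if ∀ i, ∀ h : i ∈ K, x ⟨q i, fun h' => (hq i).1 h' h⟩ = y ⟨q i, fun h' => (hq i).1 h' h⟩
        then 1 else 0 := by
  have h := hT.2 K hK
  set px : {i // i ∈ K} → Fin D := fun i => x ⟨q i, fun h' => (hq i).1 h' i.2⟩ with hpx
  set py : {i // i ∈ K} → Fin D := fun i => y ⟨q i, fun h' => (hq i).1 h' i.2⟩ with hpy
  -- The indices are swapped because the conjugate falls on the second factor of $TT^\dagger$, while
  -- here it belongs to `x`.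
  have h1 := congrFun (congrFun h py) px
  rw [Matrix.mul_apply, Matrix.one_apply] at h1
  let e : {i // i ∉ K} ≃ {l // l ∈ O} := Equiv.ofBijective (fun i => ⟨q i, (hq i).2 i.2⟩)
    ⟨fun i j h => Subtype.ext (hinj i j i.2 j.2 (congrArg Subtype.val h)), fun l => by
      obtain ⟨i, hi⟩ := hO l l.2
      exact ⟨⟨i, (hq i).1 (hi ▸ l.2)⟩, Subtype.ext hi⟩⟩
  have hg : ∀ (o : {l // l ∈ O} → Fin D) (z : {l // l ∉ O} → Fin D),
      T (fun i => glue O o z (q i)) = tensorMatrix T K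
        (fun i => z ⟨q i, fun h' => (hq i).1 h' i.2⟩) (fun i => o (e i)) := fun o z => by
    unfold tensorMatrix
    congr 1
    ext i
    by_cases hi : i ∈ K
    · rw [dif_pos hi, glue_of_notMem _ _ fun h' => (hq i).1 h' hi]
    · rw [dif_neg hi, glue_of_mem _ _ ((hq i).2 hi)]; rfl
  refine (Fintype.sum_equiv (Equiv.arrowCongr e.symm (Equiv.refl (Fin D))) _
    (fun r => conj (tensorMatrix T K px r) * tensorMatrix T K py r)
    fun o => by rw [hg, hg]; rfl).trans ?_
  refine Eq.trans (Finset.sum_congr rfl fun r _ => ?_) (h1.trans (if_congr ?_ rfl rfl))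
  · rw [Matrix.conjTranspose_apply, mul_comm]; rfl
  · rw [funext_iff]
    exact ⟨fun h i hi => (h ⟨i, hi⟩).symm, fun h i => (h i i.2).symm⟩

open Classical in
/-- If the legs of a network can be oriented without cycles, with equally many legs going in and
out at every vertex, such that all cut legs go in, then the block is an isometry up to scale. -/
theorem isIsometryUpToScale_blockMap (inc : Dart → Prop)
    (hflip : ∀ d, inc (N.flip d) ↔ ¬ inc d)
    (hhalf : ∀ v, 2 * (Finset.univ.filter fun d : {d // N.site d = some v} => inc d.1).card
      = Fintype.card {d // N.site d = some v})
    (hlast : ∀ W : Set V, W.Nonempty → ∃ v ∈ W, ∀ d, N.site d = some v → ¬ inc d →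
      ∀ w ∈ W, N.site (N.flip d) ≠ some w)
    (hcut : ∀ d ∈ N.side S A, N.flip d ∉ N.side S A → inc d) :
    IsIsometryUpToScale (N.blockMap S A) := by
  have hD : Nonempty (Fin D) := ⟨⟨0, N.dim_pos⟩⟩
  let q : N.side S A → N.SideLeg S A := Quot.mk _
  have hq : ∀ {d e}, q d = q e → d = e ∨ N.flip d.1 = e.1 := sideLeg_eq
  have hqflip : ∀ d e : N.side S A, N.flip d.1 = e.1 → q d = q e := fun d e h => Quot.sound h
  let at' : (v : S) → {d // N.site d = some v.1} → N.side S A :=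
    fun v d => ⟨d.1, Or.inr ⟨v, v.2, d.2⟩⟩
  let inn : S → Finset (N.SideLeg S A) := fun v =>
    (Finset.univ.filter fun d : {d // N.site d = some v.1} => inc d.1).image fun d => q (at' v d)
  let out : S → Finset (N.SideLeg S A) := fun v =>
    (Finset.univ.filter fun d : {d // N.site d = some v.1} => ¬ inc d.1).image fun d => q (at' v d)
  let bl : N.BoundaryLeg A → N.side S A := fun d => ⟨d.1, Or.inl d.2⟩
  let cl : N.CutLeg S A → N.side S A := fun d => ⟨d.1, d.2.1⟩
  let A' : Finset (N.SideLeg S A) := Finset.univ.image fun d => q (bl d)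
  let t : S → (N.SideLeg S A → Fin D) → ℂ := fun v x => N.tensor v fun d => x (q (at' v d))
  have hinn : ∀ {v l}, l ∈ inn v ↔ ∃ d, inc d.1 ∧ q (at' v d) = l := by simp [inn]
  have hout : ∀ {v l}, l ∈ out v ↔ ∃ d, ¬ inc d.1 ∧ q (at' v d) = l := by simp [out]
  have hsite : ∀ {v w : S} (d : {d // N.site d = some v.1}) (e : {d // N.site d = some w.1}),
      d.1 = e.1 → v = w := fun {v w} d e h => by
    have := d.2
    rw [h, e.2] at this
    exact Subtype.ext (Option.some.inj this).symm
  have hlast' : ∀ W : Finset S, W.Nonempty → ∃ v ∈ W, ∀ w ∈ W, Disjoint (out v) (inn w) := by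
    intro W hW
    obtain ⟨v, ⟨v, hv, rfl⟩, h⟩ := hlast (Subtype.val '' (W : Set S)) (hW.to_set.image _)
    refine ⟨v, hv, fun w hw => Finset.disjoint_left.2 fun l hl hl' => ?_⟩
    obtain ⟨d, hd, rfl⟩ := hout.1 hl
    obtain ⟨e, he, hde⟩ := hinn.1 hl'
    rcases hq hde with h' | h'
    · have h'' : e.1 = d.1 := congrArg Subtype.val h'
      exact hd (h'' ▸ he)
    · refine h d d.2 hd w ⟨w, hw, rfl⟩ ?_
      have h'' : N.flip e.1 = d.1 := h'
      rw [← h'', N.flip_flip, e.2]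
  -- Acyclicity for a single vertex excludes loops.
  have hself : ∀ v, Disjoint (out v) (inn v) := fun v => by
    obtain ⟨w, hw, h⟩ := hlast' {v} ⟨v, by simp⟩
    rw [Finset.mem_singleton] at hw
    subst hw
    exact h w (by simp)
  have hmem_out : ∀ v d, q (at' v d) ∈ out v ↔ ¬ inc d.1 := fun v d =>
    ⟨fun h hd => Finset.disjoint_left.1 (hself v) h (hinn.2 ⟨d, hd, rfl⟩),
      fun h => hout.2 ⟨d, h, rfl⟩⟩
  have hdep : ∀ v x y, (∀ l, l ∈ inn v ∨ l ∈ out v → x l = y l) → t v x = t v y := by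
    intro v x y h
    refine congrArg (N.tensor v) (funext fun d => h _ ?_)
    by_cases hd : inc d.1
    · exact Or.inl (hinn.2 ⟨d, hd, rfl⟩)
    · exact Or.inr (hout.2 ⟨d, hd, rfl⟩)
  have hiso : ∀ v (x y : {l // l ∉ out v} → Fin D),
      ∑ o, conj (t v (glue (out v) o x)) * t v (glue (out v) o y)
        = if ∀ l, l.1 ∈ inn v → x l = y l then 1 else 0 := by
    intro v x y
    have hinj : ∀ d e : {d // N.site d = some v.1},
        d ∉ (Finset.univ.filter fun d : {d // N.site d = some v.1} => inc d.1) →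
        e ∉ (Finset.univ.filter fun d : {d // N.site d = some v.1} => inc d.1) →
        q (at' v d) = q (at' v e) → d = e := by
      intro d e hd he h
      simp only [Finset.mem_filter, Finset.mem_univ, true_and] at hd he
      rcases hq h with h | h
      · exact Subtype.ext (congrArg (fun z : N.side S A => z.1) h)
      · exact absurd ((hflip _).2 hd) (by rw [show N.flip d.1 = e.1 from h]; exact he)
    have hO : ∀ l ∈ out v, ∃ d, q (at' v d) = l := fun l hl => by
      obtain ⟨d, -, h⟩ := hout.1 hl
      exact ⟨d, h⟩
    have key := sum_conj_mul_tensorMatrix (N.tensor v) (N.perfect v)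
      (Finset.univ.filter fun d : {d // N.site d = some v.1} => inc d.1) (hhalf v) (out v)
      (fun d => q (at' v d)) (fun d => by simp [hmem_out]) hinj hO x y
    by_cases hc : ∀ l : {l // l ∉ out v}, l.1 ∈ inn v → x l = y l
    · rw [if_pos hc]
      exact key.trans (if_pos fun d hd => hc _ (hinn.2 ⟨d, by simpa using hd, rfl⟩))
    · rw [if_neg hc]
      refine key.trans (if_neg fun h => hc ?_)
      rintro ⟨l, hl⟩ hl'
      obtain ⟨d, hd, rfl⟩ := hinn.1 hl'
      exact h d (by simpa using hd)
  have hdinn : ∀ v w, v ≠ w → Disjoint (inn v) (inn w) := by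
    intro v w hvw
    refine Finset.disjoint_left.2 fun l hl hl' => hvw ?_
    obtain ⟨d, hd, rfl⟩ := hinn.1 hl
    obtain ⟨e, he, hde⟩ := hinn.1 hl'
    rcases hq hde with h | h
    · exact (hsite e d (congrArg Subtype.val h)).symm
    · exact absurd he ((hflip _).1 (by rw [show N.flip e.1 = d.1 from h]; exact hd))
  have hdout : ∀ v w, v ≠ w → Disjoint (out v) (out w) := by
    intro v w hvw
    refine Finset.disjoint_left.2 fun l hl hl' => hvw ?_
    obtain ⟨d, hd, rfl⟩ := hout.1 hl
    obtain ⟨e, he, hde⟩ := hout.1 hl'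
    rcases hq hde with h | h
    · exact (hsite e d (congrArg Subtype.val h)).symm
    · exact absurd ((hflip _).2 he) (by rw [show N.flip e.1 = d.1 from h]; exact hd)
  -- Cut legs are never outputs, so fixing their values does not interfere with removing gates.
  have hcl : ∀ v d, q (cl d) ∉ out v := fun v d h => by
    obtain ⟨e, he, hde⟩ := hout.1 h
    rcases hq hde with h | h
    · exact he (by rw [show e.1 = d.1 from congrArg Subtype.val h]; exact hcut d.1 d.2.1 d.2.2)
    · apply d.2.2
      rw [← show N.flip e.1 = d.1 from h, N.flip_flip]
      exact (at' v e).2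
  -- Legs that are no gate's input lie on the boundary, so closing the circuit along `A'` closes it
  -- along all of them.
  have hcover : ∀ l, l ∈ A' ∨ ∃ v, l ∈ inn v := by
    intro l
    induction l using Quot.ind with
    | mk d =>
      obtain ⟨d, hd⟩ := d
      by_cases hA : N.site d = none ∧ d ∈ A
      · exact Or.inl (Finset.mem_image.2 ⟨⟨d, hA⟩, Finset.mem_univ _, rfl⟩)
      obtain ⟨v, hv, hdv⟩ := hd.resolve_left hA
      by_cases hi : inc d
      · exact Or.inr ⟨⟨v, hv⟩, hinn.2 ⟨⟨d, hdv⟩, hi, rfl⟩⟩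
      have hf : N.flip d ∈ N.side S A := by
        by_contra h; exact hi (hcut d hd h)
      have hfq : q ⟨N.flip d, hf⟩ = q ⟨d, hd⟩ := hqflip _ _ (N.flip_flip d)
      rcases hf with hf' | ⟨w, hw, hdw⟩
      · exact Or.inl (Finset.mem_image.2 ⟨⟨_, hf'⟩, Finset.mem_univ _, hfq⟩)
      · exact Or.inr ⟨⟨w, hw⟩, hinn.2 ⟨⟨_, hdw⟩, (hflip d).2 hi, hfq⟩⟩
  have hclinj : Function.Injective fun d => q (cl d) := fun d e h => by
    rcases hq h with h | h
    · exact Subtype.ext (congrArg (fun z : N.side S A => z.1) h)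
    · exact absurd ((show N.flip d.1 = e.1 from h) ▸ e.2.1) d.2.2
  -- The numerator counts configurations with prescribed cut legs; the denominator collects one
  -- factor per gate output from `circuit_sum`.
  set r : ℝ := (D : ℝ) ^ (Fintype.card (N.SideLeg S A) - Fintype.card (N.CutLeg S A))
    / (D : ℝ) ^ (∑ v, (out v).card) with hr
  have hD0 : (0 : ℝ) < D := Nat.cast_pos.2 N.dim_pos
  refine isIsometryUpToScale_of_conjTranspose_mul _ (r := r) (by positivity) ?_
  ext k k'
  let B : (N.SideLeg S A → Fin D) → (N.SideLeg S A → Fin D) → ℂ := fun x y =>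
    if (∀ d, x (q (cl d)) = k d) ∧ (∀ d, y (q (cl d)) = k' d) then 1 else 0
  have hB := circuit_sum inn out t hdep hiso hdinn hdout hlast' A' B (fun v x x' y y' hx hy => by
    refine if_congr ?_ rfl rfl
    refine and_congr (forall_congr' fun d => ?_) (forall_congr' fun d => ?_)
    · rw [hx _ (hcl v d)]
    · rw [hy _ (hcl v d)]) Finset.univ
  have hM : ((N.blockMap S A)ᴴ * N.blockMap S A) k k' = ∑ x, ∑ y,
      if ∀ l, (l ∈ A' ∨ ∀ w ∈ Finset.univ, l ∉ inn w) → x l = y l then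
        B x y * ∏ w, (conj (t w x) * t w y) else 0 := by
    rw [Matrix.mul_apply]
    simp only [Matrix.conjTranspose_apply, blockMap_apply]
    refine (sum_conj_mul_restrict (fun d => q (bl d)) (fun x => ∀ d, x (q (cl d)) = k d)
      (fun x => ∀ d, x (q (cl d)) = k' d) fun x => ∏ v, t v x).trans ?_
    refine Finset.sum_congr rfl fun x _ => Finset.sum_congr rfl fun y _ => if_congr ?_ ?_ rfl
    · constructor
      · intro h l hl
        rcases hl with hl | hl
        · obtain ⟨d, -, rfl⟩ := Finset.mem_image.1 hl
          exact h d
        · rcases hcover l with h' | ⟨v, hv⟩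
          · obtain ⟨d, -, rfl⟩ := Finset.mem_image.1 h'
            exact h d
          · exact absurd hv (hl v (Finset.mem_univ v))
      · exact fun h d => h _ (Or.inl (Finset.mem_image_of_mem _ (Finset.mem_univ d)))
    · rw [map_prod, ← Finset.prod_mul_distrib]
  have hBB : ∑ x, B x x = if k = k' then
      (D : ℂ) ^ (Fintype.card (N.SideLeg S A) - Fintype.card (N.CutLeg S A)) else 0 := by
    simp only [B, Finset.sum_boole]
    split_ifs with hk
    · subst hk
      simp only [and_self]
      rw [card_comp_eq (fun d => q (cl d)) hclinj k, Fintype.card_fin, Nat.cast_pow]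
    · rw [Nat.cast_eq_zero, Finset.card_eq_zero, Finset.filter_eq_empty_iff]
      rintro x - ⟨h1, h2⟩
      exact hk (funext fun d => (h1 d).symm.trans (h2 d))
  have hD1 : (D : ℂ) ≠ 0 := Nat.cast_ne_zero.2 N.dim_pos.ne'
  have hB' : ((N.blockMap S A)ᴴ * N.blockMap S A) k k' * (D : ℂ) ^ (∑ v, (out v).card)
      = if k = k' then
        (D : ℂ) ^ (Fintype.card (N.SideLeg S A) - Fintype.card (N.CutLeg S A)) else 0 := by
    rw [hM, ← hBB]
    convert hB
    rw [Fintype.card_fin]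
  rw [Matrix.smul_apply, Matrix.one_apply, hr, eq_div_of_mul_eq (pow_ne_zero _ hD1) hB']
  split_ifs <;> simp

end HaPPYNetwork

/-! ### The rank of the state, and isometry of minimal cuts. -/

theorem IsIsometryUpToScale.exists_mul_eq_one {m n : Type*} [Fintype m] [Fintype n]
    [DecidableEq n] {M : Matrix m n ℂ} (h : IsIsometryUpToScale M) :
    ∃ Y : Matrix n m ℂ, Y * M = 1 := by
  obtain ⟨c, -, hc⟩ := h
  rw [Matrix.mul_smul, ← Matrix.smul_mul] at hc
  refine ⟨_, hc.trans ?_⟩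
  congr!

-- For `D = 1` there is one configuration, and its value has modulus one.
open Classical in
theorem IsPerfectTensor.ne_zero {L : Type*} [Fintype L] {D : ℕ} {T : (L → Fin D) → ℂ}
    (hT : IsPerfectTensor T) (hD : D = 1) (x : L → Fin D) : T x ≠ 0 := by
  subst hD
  intro hx
  obtain ⟨n, hn⟩ := hT.1
  obtain ⟨K, -, hK⟩ := Finset.exists_subset_card_eq (s := (Finset.univ : Finset L)) (n := n)
    (by rw [Finset.card_univ]; omega)
  have h := congrFun (congrFun (hT.2 K (by omega)) fun _ => 0) fun _ => 0
  rw [Matrix.mul_apply, Matrix.one_apply_eq] at h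
  refine zero_ne_one (Eq.trans (Finset.sum_eq_zero fun r _ => ?_).symm h)
  rw [tensorMatrix, Subsingleton.elim (fun l => _) x, hx, zero_mul]

namespace DiskGraph

variable {V Dart : Type*} [Fintype V] [Fintype Dart] (G : DiskGraph V Dart)

theorem mem_side_compl {S : Set V} {A : Set Dart} {d : Dart} :
    d ∈ G.side Sᶜ Aᶜ ↔ d ∉ G.side S A := by
  rcases h : G.site d with _ | v <;> simp [side, h]

/-- The cut legs, represented by their ends on the other side. -/
def cutLegFlip (S : Set V) (A : Set Dart) : G.CutLeg Sᶜ Aᶜ ≃ G.CutLeg S A where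
  toFun d := ⟨G.flip d.1, not_not.1 fun h => d.2.2 (G.mem_side_compl.2 h),
    by rw [G.flip_flip]; exact G.mem_side_compl.1 d.2.1⟩
  invFun d := ⟨G.flip d.1, G.mem_side_compl.2 d.2.2,
    by rw [G.flip_flip]; exact fun h => G.mem_side_compl.1 h d.2.1⟩
  left_inv d := Subtype.ext (G.flip_flip d.1)
  right_inv d := Subtype.ext (G.flip_flip d.1)

theorem Interval.isBoundaryFace_first {G : DiskGraph V Dart} (A : G.Interval) :
    G.IsBoundaryFace A.first :=
  ⟨_, (G.site_rot_inv _).trans A.start_boundary, rfl⟩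

end DiskGraph

namespace HaPPYNetwork

variable {V Dart : Type*} [Fintype V] [Fintype Dart] {D : ℕ} (N : HaPPYNetwork V Dart D)

open Classical in
/-- The state of the whole network, as a matrix between the boundary legs in `A` and the other
boundary legs. -/
noncomputable def stateMatrix (A : Set Dart) :
    Matrix (N.BoundaryLeg A → Fin D) (N.BoundaryLeg Aᶜ → Fin D) ℂ :=
  fun a b => ∑ h : Dart → Fin D,
    if (∀ d : N.BoundaryLeg A, h d.1 = a d) ∧ (∀ d : N.BoundaryLeg Aᶜ, h d.1 = b d) ∧
       (∀ d e, N.flip d = e → h d = h e)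
    then ∏ v, N.tensor v fun d => h d.1
    else 0

open Classical in
/-- The configurations of all darts are pairs of configurations of the two sides. -/
noncomputable def sideProdEquiv (S : Set V) (A : Set Dart) (α : Type*) :
    ((N.side S A → α) × (N.side Sᶜ Aᶜ → α)) ≃ (Dart → α) where
  toFun h d := if hd : d ∈ N.side S A then h.1 ⟨d, hd⟩ else h.2 ⟨d, N.mem_side_compl.2 hd⟩
  invFun h := ⟨fun d => h d.1, fun d => h d.1⟩
  left_inv h := by
    refine Prod.ext (funext fun d => ?_) (funext fun d => ?_)
    · exact dif_pos d.2
    · exact dif_neg (N.mem_side_compl.1 d.2)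
  right_inv h := by
    ext d
    dsimp only
    split_ifs <;> rfl

theorem sum_mul_sum_restrict {X Y K : Type*} [Fintype X] [Fintype Y] [Fintype K] [DecidableEq K]
    (P : X → Prop) (Q : Y → Prop) [DecidablePred P] [DecidablePred Q] (κ : X → K) (μ : Y → K)
    (f : X → ℂ) (g : Y → ℂ) :
    ∑ k, (∑ x, if P x ∧ κ x = k then f x else 0) * (∑ y, if Q y ∧ μ y = k then g y else 0)
      = ∑ z : X × Y, if P z.1 ∧ Q z.2 ∧ κ z.1 = μ z.2 then f z.1 * g z.2 else 0 := by
  simp_rw [Finset.sum_mul_sum, Fintype.sum_prod_type]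
  rw [Finset.sum_comm]
  refine Finset.sum_congr rfl fun x _ => ?_
  rw [Finset.sum_comm]
  refine Finset.sum_congr rfl fun y _ => ?_
  rw [Finset.sum_eq_single (κ x)]
  · by_cases hP : P x <;> by_cases hQ : Q y <;> simp [hP, hQ, eq_comm]
  · intro k _ hk
    rw [if_neg fun h => hk h.2.symm, zero_mul]
  · simp

open Classical in
/-- The network is obtained by gluing the two sides of a cut. -/
theorem stateMatrix_eq (S : Set V) (A : Set Dart) :
    N.stateMatrix A = N.blockMap S A *
      (((N.blockMap Sᶜ Aᶜ).submatrix id fun k d => k (N.cutLegFlip S A d))ᵀ :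
        Matrix (N.CutLeg S A → Fin D) (N.BoundaryLeg Aᶜ → Fin D) ℂ) := by
  ext a b
  rw [Matrix.mul_apply]
  simp only [Matrix.transpose_apply, Matrix.submatrix_apply, id, blockMap, stateMatrix]
  -- Writing the cut condition as an equation with `k` lets the sum over `k` glue the two sides.
  have h1 : ∀ k : N.CutLeg S A → Fin D, ∀ h : N.side S A → Fin D,
      ((∀ d : N.BoundaryLeg A, h ⟨d.1, Or.inl d.2⟩ = a d) ∧
       (∀ d : N.CutLeg S A, h ⟨d.1, d.2.1⟩ = k d) ∧
       (∀ d e : N.side S A, N.flip d.1 = e.1 → h d = h e)) ↔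
      (((∀ d : N.BoundaryLeg A, h ⟨d.1, Or.inl d.2⟩ = a d) ∧
       (∀ d e : N.side S A, N.flip d.1 = e.1 → h d = h e)) ∧
       (fun d : N.CutLeg S A => h ⟨d.1, d.2.1⟩) = k) := fun k h => by
    rw [funext_iff]; tauto
  have h2 : ∀ k : N.CutLeg S A → Fin D, ∀ h : N.side Sᶜ Aᶜ → Fin D,
      ((∀ d : N.BoundaryLeg Aᶜ, h ⟨d.1, Or.inl d.2⟩ = b d) ∧
       (∀ d : N.CutLeg Sᶜ Aᶜ, h ⟨d.1, d.2.1⟩ = k (N.cutLegFlip S A d)) ∧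
       (∀ d e : N.side Sᶜ Aᶜ, N.flip d.1 = e.1 → h d = h e)) ↔
      (((∀ d : N.BoundaryLeg Aᶜ, h ⟨d.1, Or.inl d.2⟩ = b d) ∧
       (∀ d e : N.side Sᶜ Aᶜ, N.flip d.1 = e.1 → h d = h e)) ∧
       (fun d : N.CutLeg S A => h ⟨((N.cutLegFlip S A).symm d).1,
        ((N.cutLegFlip S A).symm d).2.1⟩) = k) := fun k h => by
    have : (∀ d : N.CutLeg Sᶜ Aᶜ, h ⟨d.1, d.2.1⟩ = k (N.cutLegFlip S A d)) ↔
        ∀ d : N.CutLeg S A, h ⟨((N.cutLegFlip S A).symm d).1,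
        ((N.cutLegFlip S A).symm d).2.1⟩ = k d := by
      rw [← (N.cutLegFlip S A).forall_congr_right]
      simp only [Equiv.symm_apply_apply]
    rw [funext_iff, this]; tauto
  simp only [h1, h2]
  refine Eq.trans ?_ (sum_mul_sum_restrict _ _ _ _ _ _).symm
  refine (Fintype.sum_equiv (N.sideProdEquiv S A (Fin D)) _ _ fun h => ?_).symm
  obtain ⟨h, h'⟩ := h
  have hj : ∀ d (hd : d ∈ N.side S A), N.sideProdEquiv S A (Fin D) (h, h') d = h ⟨d, hd⟩ :=
    fun d hd => dif_pos hd
  have hj' : ∀ d (hd : d ∈ N.side Sᶜ Aᶜ), N.sideProdEquiv S A (Fin D) (h, h') d = h' ⟨d, hd⟩ :=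
    fun d hd => dif_neg (N.mem_side_compl.1 hd)
  generalize N.sideProdEquiv S A (Fin D) (h, h') = H at hj hj'
  refine if_congr ?_ ?_ rfl
  · constructor
    · rintro ⟨⟨ha, hc⟩, ⟨hb, hc'⟩, hcut⟩
      refine ⟨fun d => (hj _ (Or.inl d.2)).trans (ha d),
        fun d => (hj' _ (Or.inl d.2)).trans (hb d), ?_⟩
      rintro d _ rfl
      by_cases hd : d ∈ N.side S A <;> by_cases he : N.flip d ∈ N.side S A
      · rw [hj _ hd, hj _ he]; exact hc _ _ rfl
      · rw [hj _ hd, hj' _ (N.mem_side_compl.2 he)]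
        exact congrFun hcut ⟨d, hd, he⟩
      · rw [hj' _ (N.mem_side_compl.2 hd), hj _ he]
        have := congrFun hcut ⟨N.flip d, he, by rwa [N.flip_flip]⟩
        refine Eq.trans ?_ this.symm
        exact congrArg h' (Subtype.ext (N.flip_flip d).symm)
      · rw [hj' _ (N.mem_side_compl.2 hd), hj' _ (N.mem_side_compl.2 he)]; exact hc' _ _ rfl
    · rintro ⟨ha, hb, hc⟩
      exact ⟨⟨fun d => (hj _ _).symm.trans (ha d),
          fun d e hde => (hj _ d.2).symm.trans ((hc _ _ hde).trans (hj _ e.2))⟩,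
        ⟨fun d => (hj' _ _).symm.trans (hb d),
          fun d e hde => (hj' _ d.2).symm.trans ((hc _ _ hde).trans (hj' _ e.2))⟩,
        funext fun d => (hj _ _).symm.trans ((hc _ _ rfl).trans (hj' _ _))⟩
  · rw [← Fintype.prod_subtype_mul_prod_subtype (fun v => v ∈ S)]
    refine congrArg₂ (· * ·) ?_ ?_
    · exact Fintype.prod_equiv (Equiv.refl _) _ _ fun v =>
        congrArg (N.tensor v.1) (funext fun d => (hj _ _).symm)
    · refine Eq.trans (Finset.prod_congr rfl fun v _ =>
        congrArg (N.tensor v.1) (funext fun d => (hj' _ _).symm)) ?_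
      congr!

variable {N} {A : N.Interval}

theorem cutDim_eq_card (γ : N.Cut A) [Fintype (N.CutLeg γ.region A.legs → Fin D)] :
    cutDim γ = Fintype.card (N.CutLeg γ.region A.legs → Fin D) := by
  rw [cutDim, ← Nat.card_eq_fintype_card, Nat.card_fun]
  simp

/-- The dimension of an isometric cut is the rank of the state. -/
theorem cutDim_le_of_isIsometricCut {γ : N.Cut A} (hγ : IsIsometricCut γ) (γ' : N.Cut A) :
    cutDim γ ≤ cutDim γ' := by
  classical
  obtain ⟨Y, hY⟩ := hγ.1.exists_mul_eq_one
  obtain ⟨Y', hY'⟩ := hγ.2.exists_mul_eq_one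
  set f : (N.CutLeg γ.region A.legs → Fin D) → (N.CutLeg γ.regionᶜ A.legsᶜ → Fin D) :=
    fun k d => k (N.cutLegFlip γ.region A.legs d) with hf
  have hfinj : Function.Injective f := fun k k' h => funext fun d => by
    have := congrFun h ((N.cutLegFlip γ.region A.legs).symm d)
    simpa [hf] using this
  -- Left inverses of both factors reduce the state to the identity on the cut space; `f` names cut
  -- legs by their other ends.
  have h1 : Y * N.stateMatrix A.legs * (Y'.submatrix f id)ᵀ = 1 := by
    have e1 : Y * N.blockMap γ.region A.legs = 1 := hY
    have e2 : Y' * N.blockMap γ.regionᶜ A.legsᶜ = 1 := hY'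
    rw [N.stateMatrix_eq γ.region, ← Matrix.mul_assoc Y, e1, Matrix.one_mul, ← Matrix.transpose_mul,
      ← Matrix.submatrix_mul _ _ f id f Function.bijective_id, e2, Matrix.submatrix_one _ hfinj,
      Matrix.transpose_one]
  have h2 : cutDim γ ≤ (N.stateMatrix A.legs).rank := by
    rw [cutDim_eq_card, ← Matrix.rank_one (R := ℂ), ← h1]
    exact (Matrix.rank_mul_le_left _ _).trans (Matrix.rank_mul_le_right _ _)
  refine h2.trans ?_
  rw [N.stateMatrix_eq γ'.region, cutDim_eq_card]
  exact (Matrix.rank_mul_le_left _ _).trans (Matrix.rank_le_card_width _)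

open Classical in
theorem isIsometryUpToScale_blockMap_of_eq_one (N : HaPPYNetwork V Dart D) (hD : D = 1) (S : Set V) (A : Set Dart) :
    IsIsometryUpToScale (N.blockMap S A) := by
  classical
  have : Subsingleton (Fin D) := by subst hD; infer_instance
  let z : Fin D := ⟨0, N.dim_pos⟩
  have h0 : N.blockMap S A (fun _ => z) (fun _ => z) ≠ 0 := by
    rw [blockMap, Fintype.sum_subsingleton _ fun _ => z, if_pos ⟨fun _ => Subsingleton.elim _ _,
      fun _ => Subsingleton.elim _ _, fun _ _ _ => Subsingleton.elim _ _⟩]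
    exact Finset.prod_ne_zero_iff.2 fun v _ => (N.perfect v).ne_zero hD _
  refine isIsometryUpToScale_of_conjTranspose_mul _
    (r := Complex.normSq (N.blockMap S A (fun _ => z) fun _ => z)) (Complex.normSq_pos.2 h0) ?_
  ext k k'
  rw [Subsingleton.elim k fun _ => z, Subsingleton.elim k' fun _ => z, Matrix.mul_apply,
    Fintype.sum_subsingleton _ fun _ => z, Matrix.smul_apply, Matrix.one_apply_eq,
    Complex.normSq_eq_conj_mul_self]
  simp

theorem evenDegrees (N : HaPPYNetwork V Dart D) : N.EvenDegrees := fun v => by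
  classical
  rw [Nat.card_eq_fintype_card]
  convert (N.perfect v).1

theorem isIsometricCut_of_card_le (γ : N.Cut A)
    (hγ : Nat.card (N.CutLeg γ.region A.legs) ≤ N.dual.dist A.first A.last) :
    IsIsometricCut γ := by
  classical
  have hG := N.evenDegrees
  have hA := A.isBoundaryFace_first
  have hne : ∀ d, N.grad A.first d ≠ 1 ↔ N.grad A.first d = -1 := fun d => by
    rcases hG.grad_eq A.first d with h | h <;> simp [h]
  have hflip : ∀ d, N.grad A.first (N.flip d) = 1 ↔ N.grad A.first d ≠ 1 := fun d => by
    rw [hne, DiskGraph.grad_flip]; omega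
  have hhalf : ∀ v, 2 * (Finset.univ.filter fun d : {d // N.site d = some v} =>
      N.grad A.first d = 1).card = Fintype.card {d // N.site d = some v} := fun v => by
    rw [Fintype.card_subtype, ← hG.two_mul_card A.first]
    congr 1
    refine Finset.card_bij (fun d _ => d.1) ?_ ?_ ?_
    · intro d hd; simpa [d.2] using hd
    · intro d _ e _ h; exact Subtype.ext h
    · intro d hd
      simp only [Finset.mem_filter, Finset.mem_univ, true_and] at hd
      exact ⟨⟨d, hd.1⟩, by simpa using hd.2, rfl⟩
  have hin : IsIsometryUpToScale (N.blockMap γ.region A.legs) := by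
    -- A dart is incoming at its vertex if the distance increases from its right to its left; the
    -- other side uses the reverse.
    refine isIsometryUpToScale_blockMap (fun d => N.grad A.first d = 1) hflip
      (fun v => by convert hhalf v) (fun W hW => ?_) fun d hd hd' => hG.grad_eq_one γ hγ hd hd'
    obtain ⟨v, hv, h⟩ := N.curved.exists_last hA (Or.inr rfl) W hW
    exact ⟨v, hv, fun d hd hd' => h d hd ((hne d).1 hd')⟩
  have hout : IsIsometryUpToScale (N.blockMap γ.regionᶜ A.legsᶜ) := by
    have := isIsometryUpToScale_blockMap (N := N) (S := γ.regionᶜ) (A := A.legsᶜ)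
      (fun d => N.grad A.first d ≠ 1) (fun d => not_congr (hflip d)) (fun v => ?_) (fun W hW => ?_)
      fun d hd hd' => ?_
    · convert this
    · have h1 := hhalf v
      have h2 := Finset.card_filter_add_card_filter_not (s := Finset.univ)
        (fun d : {d // N.site d = some v} => N.grad A.first d = 1)
      rw [Finset.card_univ] at h2
      convert (show 2 * (Finset.univ.filter fun d : {d // N.site d = some v} =>
        ¬ N.grad A.first d = 1).card = Fintype.card {d // N.site d = some v} by omega)
    · obtain ⟨v, hv, h⟩ := N.curved.exists_last hA (Or.inl rfl) W hW
      exact ⟨v, hv, fun d hd hd' => h d hd (not_not.1 hd')⟩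
    · rw [N.mem_side_compl] at hd hd'
      exact (hflip d).1 (hG.grad_eq_one γ hγ (not_not.1 hd') (by rwa [N.flip_flip]))
  refine ⟨?_, ?_⟩
  · convert hin; rfl
  · convert hout; rfl

end HaPPYNetwork

theorem mainTheorem1 {V Dart : Type*} [Fintype V] [Fintype Dart] {D : ℕ}
    (N : HaPPYNetwork V Dart D) (A : N.Interval) (γ : N.Cut A) :
    HaPPYNetwork.IsIsometricCut γ ↔
      ∀ γ' : N.Cut A,
        Real.log (HaPPYNetwork.cutDim γ : ℝ) ≤ Real.log (HaPPYNetwork.cutDim γ' : ℝ) := by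
  have hpos : ∀ γ : N.Cut A, (0 : ℝ) < HaPPYNetwork.cutDim γ := fun γ =>
    Nat.cast_pos.2 (pow_pos N.dim_pos _)
  constructor
  · intro h γ'
    exact Real.log_le_log (hpos γ) (Nat.cast_le.2 (HaPPYNetwork.cutDim_le_of_isIsometricCut h γ'))
  · intro h
    -- For `D = 1` all cuts have dimension 1, so minimality does not bound their length; but then
    -- each block is a nonzero scalar.
    rcases Nat.eq_or_lt_of_le (Nat.succ_le_of_lt N.dim_pos) with hD | hD
    · have h1 := HaPPYNetwork.isIsometryUpToScale_blockMap_of_eq_one N hD.symm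
      refine ⟨?_, ?_⟩
      · convert h1 γ.region A.legs; rfl
      · convert h1 γ.regionᶜ A.legsᶜ; rfl
    · obtain ⟨γ', hγ'⟩ := N.evenDegrees.exists_geodesic_cut A
      refine HaPPYNetwork.isIsometricCut_of_card_le γ ?_
      have h1 := Nat.cast_le.1 ((Real.log_le_log_iff (hpos γ) (hpos γ')).1 (h γ'))
      rw [← hγ']
      exact (Nat.pow_le_pow_iff_right hD).1 h1
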